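/- Let $\varepsilon_B,\ell_B>0$ and let $$H_B=\frac{\varepsilon_B}{2}\big(K_1^2+K_2^2\big),\qquad K_1=-\mathrm{i}\,\ell_B\partial_{x_1}-\frac{x_2}{2\ell_B},\qquad K_2=-\mathrm{i}\,\ell_B\partial_{x_2}+\frac{x_1}{2\ell_B}$$ be the Landau Hamiltonian, self-adjoint on $L^2(\mathbb{R}^2)$ as the closure of its restriction to the Schwartz functions. For $j\in\mathbb{N}_0$ let $\Pi_j$ be the Landau projection, i.e. the orthogonal projection onto the eigenspace of $H_B$ for $E_j=\varepsilon_B(j+\frac12)$. Let $\mathcal{M}_B$ be the von Neumann algebra generated by $\{\Pi_j\}_{j\in\mathbb{N}_0}$; each $T\in\mathcal{M}_B$ satisfies $T\Pi_k=\delta_k(T)\,\Pi_k$ with $\delta_k(T)\in\mathbb{C}$. Let $\mathcal{M}^1_B$ be the ideal of those $T\in\mathcal{M}_B$ with $\sum_{k}|\delta_k(T)|<\infty$. Let $$Q_B=\sum_{j=1}^2\Big(-\ell_B^2\,\partial_{x_j}^2+\frac{x_j^2}{4\ell_B^2}\Big),\qquad \Omega_B=\pi\ell_B^2 ,$$ where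 $Q_B$ is the harmonic oscillator, self-adjoint as the closure of its restriction to the Schwartz functions. For a compact operator $T$ on a Hilbert space let $\mu_n(T)$, $n\geq 0$, be its singular values in decreasing order, $\|T\|_1=\sum_n\mu_n(T)$ its trace norm and $\gamma_N(T)=\frac{1}{\log N}\sum_{n<N}\mu_n(T)$ for $N>1$. The Dixmier ideal $\mathcal{L}^{1^+}$ is the set of compact $T$ with $\sup_{N>1}\gamma_N(T)<\infty$, and $T\in\mathcal{L}^{1^+}$ is measurable if $(\gamma_N(T))_N$ converges. Put $\sigma_s(T)=\inf\{\|R\|_1+s\|S\| : R,S \text{ compact},\ R+S=T\}$ and, for $r\geq r_0>\mathrm{e}$, $\tau_r(T)=\frac{1}{\log r}\int_{r_0}^r\frac{\sigma_s(T)}{\log s}\frac{\mathrm{d}s}{s}$. For $r_0>\mathrm{e}$ and a positive normalized linear form $\omega$ on $C_b([r_0,\infty))$ that vanishes on $C_0([r_0,\infty))$, the Dixmier trace is $\mathrm{Tr}_{\mathrm{Dix},\omega}(T)=\omega\big(r\mapsto\tau_r(T)\big)$ for positive $T\in\mathcal{L}^{1^+}$, extended by linearity to $\mathcal{L}^{1^+}$.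 One writes $\mathrm{Tr}_{\mathrm{Dix}}(T)$ when $T$ is measurable and the value does not depend on $r_0$ and $\omega$. **Theorem.** Let $T\in\mathcal{M}^1_B$. For every $\xi\geq0$ the bounded inverse $Q_{B,\xi}^{-1}=(Q_B+2\xi\mathbf{1})^{-1}$ exists, $Q_{B,\xi}^{-1}T$ is a measurable element of the Dixmier ideal, and $\mathrm{Tr}_{\mathrm{Dix}}(Q_{B,\xi}^{-1}T)$ is well defined and does not depend on $\xi$. For every increasing sequence of compact sets $\Lambda_n\nearrow\mathbb{R}^2$ satisfying the Følner condition ($|(x+\Lambda_n)\,\triangle\,\Lambda_n|/|\Lambda_n|\to0$ for all $x\in\mathbb{R}^2$), all the operators $\chi_{\Lambda_n}T\chi_{\Lambda_n}$ are trace class and $$\lim_{n\to\infty}\frac{1}{|\Lambda_n|}\,\mathrm{Tr}_{L^2(\mathbb{R}^2)}\big(\chi_{\Lambda_n}T\chi_{\Lambda_n}\big)\;=\;\frac{1}{2\Omega_B}\,\mathrm{Tr}_{\mathrm{Dix}}\big(Q_{B,\xi}^{-1}T\big)\qquad\text{for all }\xi\geq0 .$$ -/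

import Mathlib

open MeasureTheory Filter Topology Complex SchwartzMap ComplexStarModule
open scoped ENNReal LineDeriv ComplexOrder InnerProductSpace BoundedContinuousFunction

noncomputable section

/-! ## Singular values, trace class operators, trace -/

section Operators

variable {H : Type*} [NormedAddCommGroup H] [InnerProductSpace ℂ H]

/-- The `n`-th singular value `μ_n(T) = inf {‖T|_{V^⊥}‖ : dim V = n}`. -/
def singularValue (T : H →L[ℂ] H) (n : ℕ) : ℝ :=
  ⨅ V : {V : Submodule ℂ H // FiniteDimensional ℂ V ∧ Module.finrank ℂ V = n},
    ‖T ∘L (V.1ᗮ).subtypeL‖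

/-- The trace norm `‖T‖₁ = Tr |T| = ∑ μ_n(T)`, with values in `[0, ∞]`. -/
def traceNorm (T : H →L[ℂ] H) : ℝ≥0∞ :=
  ∑' n, ENNReal.ofReal (singularValue T n)

/-- `T` is trace class and `Tr T = z`: for every orthonormal basis `(b_n)` the series
`∑ ⟨b_n, T b_n⟩` converges absolutely to `z`. -/
def HasTrace (T : H →L[ℂ] H) (z : ℂ) : Prop :=
  traceNorm T < ∞ ∧ ∀ b : HilbertBasis ℕ ℂ H, HasSum (fun n => ⟪b n, T (b n)⟫_ℂ) z

/-! ## The Dixmier ideal and the Dixmier traces -/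

/-- `γ_N(T) = (log N)⁻¹ ∑_{n < N} μ_n(T)`, used for `N > 1`. -/
def dixmierGamma (T : H →L[ℂ] H) (N : ℕ) : ℝ :=
  (∑ n ∈ Finset.range N, singularValue T n) / Real.log N

/-- The Dixmier ideal `𝓛^{1+}`: compact operators with `sup_{N > 1} γ_N(T) < ∞`. -/
def dixmierIdeal (H : Type*) [NormedAddCommGroup H] [InnerProductSpace ℂ H] :
    Set (H →L[ℂ] H) :=
  {T | IsCompactOperator T ∧ ∃ C : ℝ, ∀ N : ℕ, 1 < N → dixmierGamma T N ≤ C}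

/-- Measurable elements of the Dixmier ideal: the sequence `γ_N(T)` converges. -/
def IsDixmierMeasurable (T : H →L[ℂ] H) : Prop :=
  T ∈ dixmierIdeal H ∧ ∃ L : ℝ, Tendsto (dixmierGamma T) atTop (𝓝 L)

/-- `σ_s(T) = inf {‖R‖₁ + s ‖S‖ : R, S compact, R + S = T}`; for compact `T` the infimum is
finite. -/
def dixmierSigma (s : ℝ) (T : H →L[ℂ] H) : ℝ :=
  (⨅ (R : H →L[ℂ] H) (S : H →L[ℂ] H) (_ : IsCompactOperator R) (_ : IsCompactOperator S)
    (_ : R + S = T), traceNorm R + ENNReal.ofReal (s * ‖S‖)).toReal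

/-- The Cesàro mean `τ_r(T) = (log r)⁻¹ ∫_{r₀}^r (σ_s(T) / log s) ds / s`, for `r ≥ r₀ > e`. -/
def dixmierTau (r₀ r : ℝ) (T : H →L[ℂ] H) : ℝ :=
  (1 / Real.log r) * ∫ s in r₀..r, dixmierSigma s T / Real.log s / s

/-- A state of the C*-algebra `C_b([r₀, ∞)) / C_0([r₀, ∞))`, as a positive normalized linear
form on `C_b([r₀, ∞))` that vanishes on `C_0([r₀, ∞))`. -/
structure StateAtInfinity (r₀ : ℝ) where
  toLinearMap : (Set.Ici r₀ →ᵇ ℂ) →ₗ[ℂ] ℂ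
  nonneg : ∀ f : Set.Ici r₀ →ᵇ ℂ, (∀ x, 0 ≤ f x) → 0 ≤ toLinearMap f
  map_one : toLinearMap 1 = 1
  map_vanishing : ∀ f : Set.Ici r₀ →ᵇ ℂ, Tendsto f atTop (𝓝 0) → toLinearMap f = 0

/-- For a positive operator `T`: the function `r ↦ τ_r(T)` lies in `C_b([r₀, ∞))` and the state
`ω` takes the value `z` on it. -/
def HasDixmierTraceOfPos {r₀ : ℝ} (ω : StateAtInfinity r₀) (T : H →L[ℂ] H) (z : ℂ) : Prop :=
  ∃ f : Set.Ici r₀ →ᵇ ℂ, (∀ r, f r = (dixmierTau r₀ r T : ℂ)) ∧ ω.toLinearMap f = z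

/-- `Tr_{Dix,ω}(T) = z` for `T` in the Dixmier ideal. The Dixmier trace is extended by linearity
from the positive cone through
`T = (Re T)⁺ - (Re T)⁻ + i ((Im T)⁺ - (Im T)⁻)`. -/
def HasDixmierTraceAt [CompleteSpace H] {r₀ : ℝ} (ω : StateAtInfinity r₀)
    (T : H →L[ℂ] H) (z : ℂ) : Prop :=
  T ∈ dixmierIdeal H ∧ ∃ z₁ z₂ z₃ z₄ : ℂ,
    HasDixmierTraceOfPos ω ((ℜ T : H →L[ℂ] H)⁺) z₁ ∧
    HasDixmierTraceOfPos ω ((ℜ T : H →L[ℂ] H)⁻) z₂ ∧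
    HasDixmierTraceOfPos ω ((ℑ T : H →L[ℂ] H)⁺) z₃ ∧
    HasDixmierTraceOfPos ω ((ℑ T : H →L[ℂ] H)⁻) z₄ ∧
    z = (z₁ - z₂) + I * (z₃ - z₄)

/-- `Tr_Dix(T) = z`: `T` is a measurable element of the Dixmier ideal, and all the Dixmier traces
take the value `z` on it. -/
def HasDixmierTrace [CompleteSpace H] (T : H →L[ℂ] H) (z : ℂ) : Prop :=
  IsDixmierMeasurable T ∧
    ∀ r₀ : ℝ, Real.exp 1 < r₀ → ∀ ω : StateAtInfinity r₀, HasDixmierTraceAt ω T z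

/-! ## Von Neumann algebra generated by a set -/

/-- The von Neumann algebra generated by a set of bounded operators: the bicommutant of
`S ∪ S*`. -/
def vonNeumannGenerated [CompleteSpace H] (S : Set (H →L[ℂ] H)) : VonNeumannAlgebra H where
  toStarSubalgebra := StarSubalgebra.centralizer ℂ
    (StarSubalgebra.centralizer ℂ S : Set (H →L[ℂ] H))
  centralizer_centralizer' := by
    simp

end Operators

/-! ## The Landau Hamiltonian and the harmonic oscillator on `L²(ℝ²)` -/

/-- The plane `ℝ²`. -/
abbrev Plane : Type := EuclideanSpace ℝ (Fin 2)

/-- The Hilbert space `L²(ℝ²)`. -/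
abbrev L2Plane : Type := Lp ℂ 2 (volume : Measure Plane)

/-- `∂/∂x_i` on Schwartz functions. -/
def partialD (i : Fin 2) : 𝓢(Plane, ℂ) →L[ℂ] 𝓢(Plane, ℂ) :=
  LineDeriv.lineDerivOpCLM ℂ 𝓢(Plane, ℂ) (EuclideanSpace.single i (1 : ℝ))

/-- Multiplication by the coordinate `x_i` on Schwartz functions. -/
def coordMul (i : Fin 2) : 𝓢(Plane, ℂ) →L[ℂ] 𝓢(Plane, ℂ) :=
  SchwartzMap.smulLeftCLM ℂ (fun x : Plane => ((x i : ℝ) : ℂ))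

theorem partialD_apply (i : Fin 2) (f : 𝓢(Plane, ℂ)) (x : Plane) :
    partialD i f x = fderiv ℝ f x (EuclideanSpace.single i (1 : ℝ)) := by
  simp [partialD, SchwartzMap.lineDerivOp_apply_eq_fderiv]

theorem coordMul_apply (i : Fin 2) (f : 𝓢(Plane, ℂ)) (x : Plane) :
    coordMul i f x = (x i : ℂ) * f x := by
  have h : (fun x : Plane => ((x i : ℝ) : ℂ)).HasTemperateGrowth :=
    (Complex.ofRealCLM ∘L (EuclideanSpace.proj i : Plane →L[ℝ] ℝ)).hasTemperateGrowth
  simp [coordMul, SchwartzMap.smulLeftCLM_apply_apply h]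

/-- The kinetic momentum `K₁ = -i ℓ ∂₁ - x₂ / (2ℓ)`. -/
def kinetic₁ (ℓ : ℝ) : 𝓢(Plane, ℂ) →L[ℂ] 𝓢(Plane, ℂ) :=
  (-(I * (ℓ : ℂ))) • partialD 0 - (1 / (2 * (ℓ : ℂ))) • coordMul 1

/-- The kinetic momentum `K₂ = -i ℓ ∂₂ + x₁ / (2ℓ)`. -/
def kinetic₂ (ℓ : ℝ) : 𝓢(Plane, ℂ) →L[ℂ] 𝓢(Plane, ℂ) :=
  (-(I * (ℓ : ℂ))) • partialD 1 + (1 / (2 * (ℓ : ℂ))) • coordMul 0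

/-- The differential expression `(ε / 2) (K₁² + K₂²)` of the Landau Hamiltonian. -/
def landauExpr (ε ℓ : ℝ) : 𝓢(Plane, ℂ) →L[ℂ] 𝓢(Plane, ℂ) :=
  ((ε : ℂ) / 2) • (kinetic₁ ℓ ∘L kinetic₁ ℓ + kinetic₂ ℓ ∘L kinetic₂ ℓ)

/-- The differential expression `∑_j (-ℓ² ∂_j² + x_j² / (4 ℓ²))` of the harmonic oscillator. -/
def oscillatorExpr (ℓ : ℝ) : 𝓢(Plane, ℂ) →L[ℂ] 𝓢(Plane, ℂ) :=
  ∑ j : Fin 2, ((-(ℓ : ℂ) ^ 2) • (partialD j ∘L partialD j) +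
    (1 / (4 * (ℓ : ℂ) ^ 2)) • (coordMul j ∘L coordMul j))

/-- The graph, in `L²(ℝ²) × L²(ℝ²)`, of the closure of the operator `A` initially defined on the
Schwartz functions: `(f, g)` belongs to it iff `f` is in the domain of the closure of `A` and `g`
is its image. Both operators below are essentially self-adjoint on the Schwartz functions, so
that this is the graph of the self-adjoint operator. -/
def closureGraph (A : 𝓢(Plane, ℂ) →L[ℂ] 𝓢(Plane, ℂ)) : Submodule ℂ (L2Plane × L2Plane) :=
  (LinearMap.range
    (((SchwartzMap.toLpCLM ℂ ℂ 2 (volume : Measure Plane)).prod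
      (SchwartzMap.toLpCLM ℂ ℂ 2 (volume : Measure Plane) ∘L A)) :
        𝓢(Plane, ℂ) →L[ℂ] L2Plane × L2Plane).toLinearMap).topologicalClosure

/-- The eigenspace `{f : A f = c f}` of the closure of `A`. -/
def closureEigenspace (A : 𝓢(Plane, ℂ) →L[ℂ] 𝓢(Plane, ℂ)) (c : ℂ) : Submodule ℂ L2Plane :=
  (closureGraph A).comap
    ((ContinuousLinearMap.id ℂ L2Plane).prod (c • ContinuousLinearMap.id ℂ L2Plane)).toLinearMap

theorem mem_closureEigenspace (A : 𝓢(Plane, ℂ) →L[ℂ] 𝓢(Plane, ℂ)) (c : ℂ) (f : L2Plane) :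
    f ∈ closureEigenspace A c ↔ (f, c • f) ∈ closureGraph A := Iff.rfl

instance closureEigenspace_completeSpace (A : 𝓢(Plane, ℂ) →L[ℂ] 𝓢(Plane, ℂ)) (c : ℂ) :
    CompleteSpace (closureEigenspace A c) := by
  refine IsClosed.completeSpace_coe (hs := ?_)
  exact (Submodule.isClosed_topologicalClosure _).preimage
    ((ContinuousLinearMap.id ℂ L2Plane).prod
      (c • ContinuousLinearMap.id ℂ L2Plane)).continuous

/-- The `j`-th Landau projection `Π_j`: the orthogonal projection onto the eigenspace of the
Landau Hamiltonian for the Landau level `E_j = ε (j + 1/2)`. -/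
def landauProjection (ε ℓ : ℝ) (j : ℕ) : L2Plane →L[ℂ] L2Plane :=
  (closureEigenspace (landauExpr ε ℓ) ((ε : ℂ) * ((j : ℂ) + 1 / 2))).starProjection

/-- The von Neumann algebra `𝓜_B` generated by the Landau projections. -/
def landauAlgebra (ε ℓ : ℝ) : VonNeumannAlgebra L2Plane :=
  vonNeumannGenerated (Set.range (landauProjection ε ℓ))

/-- The ideal `𝓜¹_B`: the `T ∈ 𝓜_B` whose Gelfand transform `t_k = δ_k(T)` is in `ℓ¹(ℕ₀)`. Here
`δ_k` is the pure state of `𝓜_B` with `δ_k(Π_j) = δ_{kj}`, that is, `T Π_k = δ_k(T) Π_k`. -/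
def landauIdeal (ε ℓ : ℝ) : Set (L2Plane →L[ℂ] L2Plane) :=
  {T | T ∈ landauAlgebra ε ℓ ∧ ∃ t : ℕ → ℂ, Summable (fun k => ‖t k‖) ∧
    ∀ k, T ∘L landauProjection ε ℓ k = t k • landauProjection ε ℓ k}

/-- `R` is the bounded inverse `Q_{B,ξ}⁻¹ = (Q_B + 2 ξ 1)⁻¹` on `L²(ℝ²)`:
`R g = f` iff `f` is in the domain of `Q_B` and `Q_B f + 2 ξ f = g`. -/
def IsOscillatorInverse (ℓ ξ : ℝ) (R : L2Plane →L[ℂ] L2Plane) : Prop :=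
  ∀ f g : L2Plane, R g = f ↔ (f, g - (2 * (ξ : ℂ)) • f) ∈ closureGraph (oscillatorExpr ℓ)

/-! ## Trace per unit volume -/

/-- Multiplication by the characteristic function of a measurable set `Λ`, as a linear map. -/
def chiMulLinear (Λ : Set Plane) (hΛ : MeasurableSet Λ) : L2Plane →ₗ[ℂ] L2Plane where
  toFun f := ((Lp.memLp f).indicator hΛ).toLp (Λ.indicator f)
  map_add' f g := by
    rw [← MemLp.toLp_add]
    refine MemLp.toLp_congr _ _ ?_
    filter_upwards [Lp.coeFn_add f g] with x hx
    by_cases h : x ∈ Λ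
    · simp only [Set.indicator_of_mem h, Pi.add_apply]
      exact hx
    · simp [h]
  map_smul' c f := by
    rw [RingHom.id_apply, ← MemLp.toLp_const_smul]
    refine MemLp.toLp_congr _ _ ?_
    filter_upwards [Lp.coeFn_smul c f] with x hx
    by_cases h : x ∈ Λ
    · simp only [Set.indicator_of_mem h, Pi.smul_apply]
      exact hx
    · simp [h]

theorem chiMulLinear_apply (Λ : Set Plane) (hΛ : MeasurableSet Λ) (f : L2Plane) :
    chiMulLinear Λ hΛ f = ((Lp.memLp f).indicator hΛ).toLp (Λ.indicator f) := rfl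

theorem chiMulLinear_ae_eq (Λ : Set Plane) (hΛ : MeasurableSet Λ) (f : L2Plane) :
    (chiMulLinear Λ hΛ f : Plane → ℂ) =ᵐ[volume] Λ.indicator (f : Plane → ℂ) := by
  rw [chiMulLinear_apply]
  exact MemLp.coeFn_toLp _

theorem norm_chiMulLinear_le (Λ : Set Plane) (hΛ : MeasurableSet Λ) (f : L2Plane) :
    ‖chiMulLinear Λ hΛ f‖ ≤ 1 * ‖f‖ := by
  rw [one_mul]
  refine Lp.norm_le_norm_of_ae_le ?_
  filter_upwards [chiMulLinear_ae_eq Λ hΛ f] with x hx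
  rw [hx]
  exact norm_indicator_le_norm_self _ _

/-- The multiplication operator `χ_Λ` on `L²(ℝ²)`. -/
def chiMul (Λ : Set Plane) (hΛ : MeasurableSet Λ) : L2Plane →L[ℂ] L2Plane :=
  (chiMulLinear Λ hΛ).mkContinuous 1 (norm_chiMulLinear_le Λ hΛ)

/-- An increasing sequence of compact sets exhausting the plane that satisfies the Følner
condition `|(x + Λ_n) ∆ Λ_n| / |Λ_n| → 0` for all `x`. -/
structure IsFoelnerExhaustion (Λ : ℕ → Set Plane) : Prop where
  isCompact : ∀ n, IsCompact (Λ n)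
  monotone : Monotone Λ
  iUnion_eq : ⋃ n, Λ n = Set.univ
  isFoelner : IsAddFoelner Plane (volume : Measure Plane) atTop Λ

/-- All the operators `χ_{Λ_n} T χ_{Λ_n}` are trace class, and
`|Λ_n|⁻¹ Tr(χ_{Λ_n} T χ_{Λ_n})` converges to `z`. -/
def HasTracePerUnitVolume {Λ : ℕ → Set Plane} (hΛ : IsFoelnerExhaustion Λ)
    (T : L2Plane →L[ℂ] L2Plane) (z : ℂ) : Prop :=
  ∃ t : ℕ → ℂ,
    (∀ n, HasTrace (chiMul (Λ n) (hΛ.isCompact n).measurableSet ∘L T ∘L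
      chiMul (Λ n) (hΛ.isCompact n).measurableSet) (t n)) ∧
    Tendsto (fun n => t n / ((volume (Λ n)).toReal : ℂ)) atTop (𝓝 z)

/-- The area `Ω_B = π ℓ²` of the magnetic disk. -/
def magneticArea (ℓ : ℝ) : ℝ := Real.pi * ℓ ^ 2

end

/-! The proof diagonalizes everything at once. Two commuting pairs of ladder operators act on
Schwartz space. Applied to the Gaussian `groundState` they produce functions `landauFun ℓ n m` that
are eigenfunctions both of the Landau Hamiltonian, for `ε (n + 1/2)`, and of the oscillator, for `n
+ m + 1`. After normalization they form a Hilbert basis of `L²` (`exists_landauBasis`), in which `T`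
has the eigenvalues `t n` and the resolvent of the oscillator, shifted by `2ξ`, has the eigenvalues
`1 / (n + m + a)` with `a = 1 + 2ξ`. Both sides of the formula are then computed separately, and
both are governed by `∑ t n`.

Dixmier side: the product has the eigenvalues `t n / (n + m + a)`. For fixed `n` the `m`-sum
diverges like `t n * log`, and the shift `a` only contributes bounded terms, so the value is `∑ t n`
whatever `ξ` is. For nonnegative weights, `dixmierSigma` is bounded above by cutting the eigenvalues
at height `1 / s` (`IsDiagonal.iInf_le`, `sum_posPart_div_sub_le`) and below by Ky Fan's inequality
on rectangles of indices (`IsDiagonal.ofReal_sum_le_iInf`, `exists_sum_div_ge`). Its quotient by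
`log s` therefore converges, hence so does the logarithmic mean, and every state at infinity returns
the limit. The general case is reduced to four nonnegative weights (`IsDiagonal.hasDixmierTrace`).

Volume side: each Landau level has constant density, `∑ₘ |ψₙₘ(x)|² = 1 / (2πℓ²)` at every point `x`
(`hasSum_norm_sq_landauState`). Integrating over `Λ` gives the exact value `|Λ| / (2πℓ²) * ∑ t n`
for the trace of the compressed operator, and `2πℓ²` is twice the magnetic area. The trace class
property comes from factoring the compression into two Hilbert–Schmidt operators
(`IsDiagonal.hasTrace_conj`). -/

/-! ### Singular values and Ky Fan's inequality. -/

section SingularValues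

variable {H : Type*} [NormedAddCommGroup H] [InnerProductSpace ℂ H]

theorem singularValue_bddBelow (T : H →L[ℂ] H) (n : ℕ) :
    BddBelow (Set.range fun V : {V : Submodule ℂ H // FiniteDimensional ℂ V ∧
      Module.finrank ℂ V = n} => ‖T ∘L (V.1ᗮ).subtypeL‖) :=
  ⟨0, by rintro _ ⟨V, rfl⟩; exact norm_nonneg (T ∘L (V.1ᗮ).subtypeL)⟩

theorem singularValue_nonneg (T : H →L[ℂ] H) (n : ℕ) : 0 ≤ singularValue T n :=
  Real.iInf_nonneg fun V => norm_nonneg (T ∘L (V.1ᗮ).subtypeL)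

theorem Submodule.exists_le_finrank_eq (hH : ¬ FiniteDimensional ℂ H) (V : Submodule ℂ H)
    [FiniteDimensional ℂ V] (n : ℕ) (hn : Module.finrank ℂ V ≤ n) :
    ∃ W : Submodule ℂ H, V ≤ W ∧ FiniteDimensional ℂ W ∧ Module.finrank ℂ W = n := by
  induction n, hn using Nat.le_induction with
  | base => exact ⟨V, le_rfl, inferInstance, rfl⟩
  | succ n _ ih =>
    obtain ⟨W, hVW, hW, hn⟩ := ih
    obtain ⟨x, hx⟩ : ∃ x, x ∉ W := by
      by_contra! h
      have : W = ⊤ := Submodule.eq_top_iff'.2 h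
      subst this
      exact hH (Module.Finite.equiv (Submodule.topEquiv : (⊤ : Submodule ℂ H) ≃ₗ[ℂ] H))
    have hx0 : x ≠ 0 := fun h => hx (h ▸ W.zero_mem)
    refine ⟨W ⊔ ℂ ∙ x, hVW.trans le_sup_left, inferInstance, ?_⟩
    have h1 := Submodule.finrank_sup_add_finrank_inf_eq W (ℂ ∙ x)
    have h2 : W ⊓ ℂ ∙ x = ⊥ := by
      rw [← disjoint_iff, Submodule.disjoint_span_singleton' hx0]
      exact hx
    rw [h2, finrank_bot, finrank_span_singleton hx0, hn] at h1
    omega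

/-- The infimum defining `singularValue` runs over subspaces of dimension exactly `n`. In infinite
dimension a smaller `V` can be padded, which only shrinks its complement. -/
theorem singularValue_le (hH : ¬ FiniteDimensional ℂ H) (T : H →L[ℂ] H) (n : ℕ)
    (V : Submodule ℂ H) [FiniteDimensional ℂ V] (hn : Module.finrank ℂ V ≤ n) {C : ℝ}
    (hC : 0 ≤ C) (h : ∀ x ∈ Vᗮ, ‖T x‖ ≤ C * ‖x‖) : singularValue T n ≤ C := by
  obtain ⟨W, hVW, hW, hWn⟩ := V.exists_le_finrank_eq hH n hn
  refine (ciInf_le (singularValue_bddBelow T n) ⟨W, hW, hWn⟩).trans ?_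
  refine ContinuousLinearMap.opNorm_le_bound _ hC fun x => ?_
  exact h x (Submodule.orthogonal_le hVW x.2)

theorem exists_norm_le_singularValue_add (hH : ¬ FiniteDimensional ℂ H) (T : H →L[ℂ] H) (n : ℕ)
    {ε : ℝ} (hε : 0 < ε) : ∃ V : Submodule ℂ H, FiniteDimensional ℂ V ∧
      Module.finrank ℂ V = n ∧ ∀ x ∈ Vᗮ, ‖T x‖ ≤ (singularValue T n + ε) * ‖x‖ := by
  obtain ⟨W, -, hW, hWn⟩ := (⊥ : Submodule ℂ H).exists_le_finrank_eq hH n (by simp)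
  have : Nonempty {V : Submodule ℂ H // FiniteDimensional ℂ V ∧ Module.finrank ℂ V = n} :=
    ⟨⟨W, hW, hWn⟩⟩
  obtain ⟨⟨V, hV, hVn⟩, h⟩ := exists_lt_of_ciInf_lt
    (show singularValue T n < singularValue T n + ε by linarith)
  refine ⟨V, hV, hVn, fun x hx => ?_⟩
  exact ((T ∘L (Vᗮ).subtypeL).le_opNorm ⟨x, hx⟩).trans
    (mul_le_mul_of_nonneg_right h.le (norm_nonneg x))

theorem Submodule.exists_unit_mem_orthogonal (E V : Submodule ℂ H) [FiniteDimensional ℂ E]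
    [FiniteDimensional ℂ V] (h : Module.finrank ℂ V < Module.finrank ℂ E) :
    ∃ x ∈ E, x ∈ Vᗮ ∧ ‖x‖ = 1 := by
  let L : E →ₗ[ℂ] V := (V.orthogonalProjectionOnto).toLinearMap ∘ₗ E.subtype
  obtain ⟨x, hx, hx0⟩ := (Submodule.ne_bot_iff _).1 (LinearMap.ker_ne_bot_of_finrank_lt (f := L) h)
  have hx' : (x : H) ∈ Vᗮ := by
    rw [← Submodule.orthogonalProjectionOnto_eq_zero_iff]
    exact hx
  have h0 : ‖(x : H)‖ ≠ 0 := by simpa using hx0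
  refine ⟨((‖(x : H)‖⁻¹ : ℝ) : ℂ) • (x : H), E.smul_mem _ x.2, Vᗮ.smul_mem _ hx', ?_⟩
  rw [norm_smul, Complex.norm_real, norm_inv, norm_norm, inv_mul_cancel₀ h0]

/-- By dimension count, a space of dimension `N + 1` contains a unit vector orthogonal to a nearly
optimal `V` of dimension `N`. It becomes the last vector, and the argument continues in its
orthogonal complement inside `E`. -/
theorem exists_orthonormal_norm_le (hH : ¬ FiniteDimensional ℂ H) (T : H →L[ℂ] H) {ε : ℝ}
    (hε : 0 < ε) (N : ℕ) (E : Submodule ℂ H) [FiniteDimensional ℂ E]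
    (hE : Module.finrank ℂ E = N) :
    ∃ f : Fin N → H, Orthonormal ℂ f ∧ (∀ i, f i ∈ E) ∧
      ∀ i, ‖T (f i)‖ ≤ singularValue T i + ε := by
  induction N generalizing E with
  | zero => exact ⟨Fin.elim0, by simp [Orthonormal], fun i => i.elim0, fun i => i.elim0⟩
  | succ N ih =>
    obtain ⟨V, hV, hVn, hVT⟩ := exists_norm_le_singularValue_add hH T N hε
    obtain ⟨x, hxE, hxV, hx⟩ := E.exists_unit_mem_orthogonal V (by omega)
    have hle : (ℂ ∙ x) ≤ E := by simpa using hxE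
    have hx0 : x ≠ 0 := by rintro rfl; simp at hx
    have hfin := Submodule.finrank_add_inf_finrank_orthogonal hle
    rw [finrank_span_singleton hx0, hE] at hfin
    have : FiniteDimensional ℂ ↥((ℂ ∙ x)ᗮ ⊓ E) := Submodule.finiteDimensional_inf_right _ _
    obtain ⟨f, hf, hfE, hfT⟩ := ih ((ℂ ∙ x)ᗮ ⊓ E) (by omega)
    have hfx : ∀ i, ⟪x, f i⟫_ℂ = 0 := fun i =>
      Submodule.mem_orthogonal_singleton_iff_inner_right.1 (hfE i).1
    refine ⟨Fin.snoc f x, ?_, ?_, ?_⟩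
    · rw [orthonormal_iff_ite] at hf ⊢
      intro i j
      induction i using Fin.lastCases with
      | last =>
        induction j using Fin.lastCases with
        | last => simp [hx]
        | cast j => simp [hfx, (Fin.castSucc_lt_last j).ne']
      | cast i =>
        induction j using Fin.lastCases with
        | last => simp [← inner_conj_symm (f i) x, hfx, (Fin.castSucc_lt_last i).ne]
        | cast j => simp [hf]
    · intro i
      induction i using Fin.lastCases with
      | last => simpa using hxE
      | cast i => simpa using (hfE i).2
    · intro i
      induction i using Fin.lastCases with
      | last => simpa [hx] using hVT x hxV
      | cast i => simpa using hfT i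

theorem Orthonormal.eq_sum_of_mem_span {κ : Type*} [Fintype κ] {f : κ → H} (hf : Orthonormal ℂ f)
    {x : H} (hx : x ∈ Submodule.span ℂ (Set.range f)) : x = ∑ i, ⟪f i, x⟫_ℂ • f i := by
  obtain ⟨c, rfl⟩ := (Submodule.mem_span_range_iff_exists_fun ℂ).1 hx
  simp [hf.inner_right_fintype]

/-- Ky Fan's inequality. -/
theorem norm_sum_inner_le_sum_singularValue (hH : ¬ FiniteDimensional ℂ H) (T : H →L[ℂ] H)
    {κ : Type*} [Fintype κ] {u e : κ → H} (hu : Orthonormal ℂ u) (he : Orthonormal ℂ e) :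
    ‖∑ i, ⟪u i, T (e i)⟫_ℂ‖ ≤ ∑ n ∈ Finset.range (Fintype.card κ), singularValue T n := by
  refine le_of_forall_pos_le_add fun δ hδ => ?_
  set N := Fintype.card κ with hN
  have hε : 0 < δ / (N + 1) := by positivity
  have hfin : Module.finrank ℂ (Submodule.span ℂ (Set.range e)) = N :=
    finrank_span_eq_card he.linearIndependent
  have : FiniteDimensional ℂ (Submodule.span ℂ (Set.range e)) :=
    FiniteDimensional.span_of_finite ℂ (Set.finite_range e)
  obtain ⟨f, hf, hfE, hfT⟩ := exists_orthonormal_norm_le hH T hε N _ hfin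
  have hspan : Submodule.span ℂ (Set.range f) = Submodule.span ℂ (Set.range e) := by
    refine Submodule.eq_of_le_of_finrank_eq (Submodule.span_le.2 ?_) ?_
    · rintro _ ⟨i, rfl⟩
      exact hfE i
    · rw [hfin, finrank_span_eq_card hf.linearIndependent, Fintype.card_fin]
  -- Changing from `e` to the adapted basis `f` of the same span carries `u` to vectors that are
  -- still of norm at most one by Bessel, so each term is at most `‖T (f n)‖`.
  have key : ∑ i, ⟪u i, T (e i)⟫_ℂ = ∑ n, ⟪∑ i, ⟪e i, f n⟫_ℂ • u i, T (f n)⟫_ℂ := by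
    simp_rw [sum_inner, inner_smul_left, inner_conj_symm]
    rw [Finset.sum_comm]
    refine Finset.sum_congr rfl fun i _ => ?_
    conv_lhs => rw [hf.eq_sum_of_mem_span (x := e i)
      (hspan ▸ Submodule.subset_span (Set.mem_range_self i))]
    simp [map_sum]
  have hw : ∀ n, ‖∑ i, ⟪e i, f n⟫_ℂ • u i‖ ≤ 1 := by
    intro n
    have h1 : ‖∑ i, ⟪e i, f n⟫_ℂ • u i‖ ^ 2 = ∑ i, ‖⟪e i, f n⟫_ℂ‖ ^ 2 := by
      have h := hu.inner_sum (fun i => ⟪e i, f n⟫_ℂ) (fun i => ⟪e i, f n⟫_ℂ) Finset.univ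
      rw [inner_self_eq_norm_sq_to_K] at h
      have h2 : ∀ z : ℂ, (starRingEnd ℂ) z * z = ((‖z‖ ^ 2 : ℝ) : ℂ) := fun z => by
        rw [Complex.conj_mul']; push_cast; rfl
      simp_rw [h2] at h
      rw [← Complex.ofReal_sum] at h
      exact Complex.ofReal_injective (by rw [← h]; push_cast; rfl)
    have h2 := he.sum_inner_products_le (f n) (s := Finset.univ)
    rw [← h1, hf.1 n] at h2
    nlinarith [norm_nonneg (∑ i, ⟪e i, f n⟫_ℂ • u i)]
  calc ‖∑ i, ⟪u i, T (e i)⟫_ℂ‖ ≤ ∑ n, ‖⟪∑ i, ⟪e i, f n⟫_ℂ • u i, T (f n)⟫_ℂ‖ := by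
        rw [key]; exact norm_sum_le _ _
    _ ≤ ∑ n : Fin N, (singularValue T n + δ / (N + 1)) := by
        refine Finset.sum_le_sum fun n _ => (norm_inner_le_norm _ _).trans ?_
        calc _ ≤ 1 * ‖T (f n)‖ := mul_le_mul_of_nonneg_right (hw n) (norm_nonneg _)
          _ ≤ _ := by rw [one_mul]; exact hfT n
    _ = (∑ n ∈ Finset.range N, singularValue T n) + N * (δ / (N + 1)) := by
        rw [Finset.sum_add_distrib, Finset.sum_range]
        simp
    _ ≤ (∑ n ∈ Finset.range N, singularValue T n) + δ := by
        have : (N : ℝ) * (δ / (N + 1)) ≤ δ := by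
          rw [mul_div_assoc', div_le_iff₀ (by positivity)]
          nlinarith
        linarith

theorem sum_singularValue_le_traceNorm (T : H →L[ℂ] H) (N : ℕ) :
    ENNReal.ofReal (∑ n ∈ Finset.range N, singularValue T n) ≤ traceNorm T := by
  rw [ENNReal.ofReal_sum_of_nonneg fun n _ => singularValue_nonneg T n]
  exact ENNReal.sum_le_tsum _

theorem traceNorm_le_of_sum_le (T : H →L[ℂ] H) {C : ℝ}
    (h : ∀ N, ∑ n ∈ Finset.range N, singularValue T n ≤ C) : traceNorm T ≤ ENNReal.ofReal C := by
  rw [traceNorm, ENNReal.tsum_eq_iSup_nat]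
  refine iSup_le fun N => ?_
  rw [← ENNReal.ofReal_sum_of_nonneg fun n _ => singularValue_nonneg T n]
  exact ENNReal.ofReal_le_ofReal (h N)

end SingularValues

/-! ### Operators diagonal in a Hilbert basis. -/

section Diagonal

variable {H : Type*} [NormedAddCommGroup H] [InnerProductSpace ℂ H] {ι : Type*}

theorem HilbertBasis.ext_inner (b : HilbertBasis ι ℂ H) {x y : H}
    (h : ∀ i, ⟪b i, x⟫_ℂ = ⟪b i, y⟫_ℂ) : x = y := by
  apply b.repr.injective
  ext i
  simpa only [b.repr_apply_apply] using h i

theorem HilbertBasis.hasSum_norm_inner_sq (b : HilbertBasis ι ℂ H) (x : H) :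
    HasSum (fun i => ‖⟪b i, x⟫_ℂ‖ ^ 2) (‖x‖ ^ 2) := by
  have h := b.hasSum_inner_mul_inner x x
  rw [inner_self_eq_norm_sq_to_K] at h
  have h2 : ∀ i, ⟪x, b i⟫_ℂ * ⟪b i, x⟫_ℂ = ((‖⟪b i, x⟫_ℂ‖ ^ 2 : ℝ) : ℂ) := fun i => by
    rw [← inner_conj_symm x (b i), Complex.conj_mul']
    push_cast
    rfl
  simp_rw [h2] at h
  rw [← Complex.hasSum_ofReal, Complex.ofReal_pow]
  exact h

/-- The operator `T` is diagonal in the Hilbert basis `b`, with eigenvalues `c i`. -/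
def IsDiagonal (b : HilbertBasis ι ℂ H) (T : H →L[ℂ] H) (c : ι → ℂ) : Prop :=
  ∀ x i, ⟪b i, T x⟫_ℂ = c i * ⟪b i, x⟫_ℂ

variable {b : HilbertBasis ι ℂ H} {S T : H →L[ℂ] H} {c d : ι → ℂ}

theorem IsDiagonal.unique (hS : IsDiagonal b S c) (hT : IsDiagonal b T c) : S = T :=
  ContinuousLinearMap.ext fun x => b.ext_inner fun i => by rw [hS, hT]

theorem IsDiagonal.congr (hT : IsDiagonal b T c) (h : ∀ i, c i = d i) : IsDiagonal b T d :=
  fun x i => by rw [hT, h]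

theorem IsDiagonal.add (hS : IsDiagonal b S c) (hT : IsDiagonal b T d) :
    IsDiagonal b (S + T) (fun i => c i + d i) := fun x i => by
  rw [add_apply, inner_add_right, hS, hT, add_mul]

theorem IsDiagonal.sub (hS : IsDiagonal b S c) (hT : IsDiagonal b T d) :
    IsDiagonal b (S - T) (fun i => c i - d i) := fun x i => by
  rw [sub_apply, inner_sub_right, hS, hT, sub_mul]

theorem IsDiagonal.smul (hS : IsDiagonal b S c) (a : ℂ) :
    IsDiagonal b (a • S) (fun i => a * c i) := fun x i => by
  rw [smul_apply, inner_smul_right, hS, mul_assoc]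

theorem IsDiagonal.comp (hS : IsDiagonal b S c) (hT : IsDiagonal b T d) :
    IsDiagonal b (S ∘L T) (fun i => c i * d i) := fun x i => by
  rw [ContinuousLinearMap.comp_apply, hS, hT, mul_assoc]

theorem IsDiagonal.apply_self (hT : IsDiagonal b T c) (i : ι) : T (b i) = c i • b i := by
  classical
  refine b.ext_inner fun j => ?_
  rw [hT, inner_smul_right, orthonormal_iff_ite.1 b.orthonormal]
  split_ifs with h
  · rw [h]
  · simp

theorem IsDiagonal.adjoint [CompleteSpace H] (hT : IsDiagonal b T c) :
    IsDiagonal b (ContinuousLinearMap.adjoint T) (fun i => (starRingEnd ℂ) (c i)) := fun x i => by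
  rw [ContinuousLinearMap.adjoint_inner_right, hT.apply_self, inner_smul_left]

theorem IsDiagonal.norm_apply_le (hT : IsDiagonal b T c) {x : H} {C : ℝ} (hC : 0 ≤ C)
    (h : ∀ i, ‖c i‖ ≤ C ∨ ⟪b i, x⟫_ℂ = 0) : ‖T x‖ ≤ C * ‖x‖ := by
  refine le_of_sq_le_sq ?_ (by positivity)
  rw [mul_pow]
  refine hasSum_le (fun i => ?_) (b.hasSum_norm_inner_sq (T x))
    ((b.hasSum_norm_inner_sq x).mul_left (C ^ 2))
  rw [hT, norm_mul, mul_pow]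
  rcases h i with h | h
  · gcongr
  · simp [h]

theorem IsDiagonal.norm_le (hT : IsDiagonal b T c) {C : ℝ} (hC : 0 ≤ C) (h : ∀ i, ‖c i‖ ≤ C) :
    ‖T‖ ≤ C :=
  T.opNorm_le_bound hC fun _ => hT.norm_apply_le hC fun i => Or.inl (h i)

theorem exists_isDiagonal (b : HilbertBasis ι ℂ H) (c : ι → ℂ) {C : ℝ} (h : ∀ i, ‖c i‖ ≤ C) :
    ∃ T : H →L[ℂ] H, IsDiagonal b T c := by
  have hmem : ∀ x : H, Memℓp (fun i => c i * ⟪b i, x⟫_ℂ) 2 := fun x => by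
    refine memℓp_gen ?_
    refine Summable.of_nonneg_of_le (fun i => by positivity) (fun i => ?_)
      ((b.hasSum_norm_inner_sq x).summable.mul_left (C ^ 2))
    simp only [ENNReal.toReal_ofNat, Real.rpow_ofNat, norm_mul, mul_pow]
    gcongr
    exact h i
  let L : H →ₗ[ℂ] H :=
    { toFun := fun x => b.repr.symm ⟨fun i => c i * ⟪b i, x⟫_ℂ, hmem x⟩
      map_add' := fun x y => by
        rw [← map_add]
        congr 1
        ext i
        simp only [inner_add_right, mul_add]
        rfl
      map_smul' := fun a x => by
        rw [← map_smul]
        congr 1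
        ext i
        simp [mul_left_comm] }
  have hL : ∀ x i, ⟪b i, L x⟫_ℂ = c i * ⟪b i, x⟫_ℂ := fun x i => by
    rw [← b.repr_apply_apply]
    simp [L]
  -- The absolute value is needed because `ι` may be empty, in which case `C` may be negative.
  refine ⟨L.mkContinuous |C| fun x => ?_, hL⟩
  refine le_of_sq_le_sq ?_ (by positivity)
  rw [mul_pow]
  refine hasSum_le (fun i => ?_) (b.hasSum_norm_inner_sq (L x))
    ((b.hasSum_norm_inner_sq x).mul_left (|C| ^ 2))
  rw [hL, norm_mul, mul_pow]
  gcongr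
  exact (h i).trans (le_abs_self C)

theorem IsDiagonal.isCompactOperator_of_support (hT : IsDiagonal b T c) (F : Finset ι)
    (hF : ∀ i ∉ F, c i = 0) : IsCompactOperator T := by
  have h : T = ∑ i ∈ F, c i • ((ContinuousLinearMap.toSpanSingleton ℂ (b i)) ∘L
      (innerSL ℂ (b i))) := by
    classical
    refine ContinuousLinearMap.ext fun x => b.ext_inner fun j => ?_
    rw [hT]
    simp only [sum_apply, smul_apply,
      ContinuousLinearMap.comp_apply, innerSL_apply_apply,
      ContinuousLinearMap.toSpanSingleton_apply, inner_sum, inner_smul_right,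
      orthonormal_iff_ite.1 b.orthonormal, mul_ite, mul_one, mul_zero, Finset.sum_ite_eq]
    split_ifs with hj
    · rfl
    · rw [hF j hj, zero_mul]
  rw [h]
  have : ∀ G : Finset ι, IsCompactOperator (∑ i ∈ G, c i •
      ((ContinuousLinearMap.toSpanSingleton ℂ (b i)) ∘L (innerSL ℂ (b i))) : H →L[ℂ] H) := by
    classical
    intro G
    induction G using Finset.induction_on with
    | empty => exact isCompactOperator_zero
    | insert i G hi ih =>
      rw [Finset.sum_insert hi]
      refine IsCompactOperator.add (IsCompactOperator.smul ?_ (c i)) ih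
      exact (isCompactOperator_of_locallyCompactSpace_dom (innerSL ℂ (b i))).clm_comp
        (ContinuousLinearMap.toSpanSingleton ℂ (b i))
  exact this F

/-- `T` is the norm limit of its truncations to finite sets of eigenvalues. -/
theorem IsDiagonal.isCompactOperator [CompleteSpace H] (hT : IsDiagonal b T c)
    (hc : Tendsto c cofinite (𝓝 0)) : IsCompactOperator T := by
  classical
  have hbd : ∀ F : Finset ι, ∃ S : H →L[ℂ] H,
      IsDiagonal b S (fun i => if i ∈ F then c i else 0) := fun F => by
    refine exists_isDiagonal b _ (C := ∑ i ∈ F, ‖c i‖) fun i => ?_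
    split_ifs with hi
    · exact Finset.single_le_sum (f := fun i => ‖c i‖) (fun _ _ => norm_nonneg _) hi
    · simpa using Finset.sum_nonneg fun i _ => norm_nonneg (c i)
  choose S hS using hbd
  refine isCompactOperator_of_tendsto (F := S) (l := atTop) (f := T) ?_
    (Eventually.of_forall fun F => (hS F).isCompactOperator_of_support F fun i hi => by simp [hi])
  rw [Metric.tendsto_atTop]
  intro ε hε
  have hfin : {i | ¬ ‖c i‖ < ε / 2}.Finite := by
    have := (tendsto_zero_iff_norm_tendsto_zero.1 hc).eventually (gt_mem_nhds (half_pos hε))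
    exact this
  refine ⟨hfin.toFinset, fun F hF => ?_⟩
  rw [dist_eq_norm]
  refine lt_of_le_of_lt (((hS F).sub hT).norm_le (half_pos hε).le fun i => ?_) (half_lt_self hε)
  by_cases hi : i ∈ F
  · simpa [hi] using (half_pos hε).le
  · have : ‖c i‖ < ε / 2 := by
      by_contra h
      exact hi (hF (by simpa using h))
    simpa [hi] using this.le

theorem HilbertBasis.not_finiteDimensional [Infinite ι] (b : HilbertBasis ι ℂ H) :
    ¬ FiniteDimensional ℂ H := fun _ =>
  Infinite.not_finite (α := ι) b.orthonormal.linearIndependent.finite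

theorem exists_forall_notMem_norm_le [Infinite ι] (hc : Tendsto c cofinite (𝓝 0))
    (F : Finset ι) : ∃ j ∉ F, ∀ i ∉ F, ‖c i‖ ≤ ‖c j‖ := by
  by_cases h : ∃ j ∉ F, c j ≠ 0
  · obtain ⟨j, hj, hj0⟩ := h
    have hfin : {i | ¬ ‖c i‖ < ‖c j‖}.Finite :=
      (tendsto_zero_iff_norm_tendsto_zero.1 hc).eventually (gt_mem_nhds (norm_pos_iff.2 hj0))
    classical
    obtain ⟨k, hk, hmax⟩ := (hfin.toFinset \ F).exists_max_image (fun i => ‖c i‖)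
      ⟨j, by simp [hj]⟩
    rw [Finset.mem_sdiff] at hk
    refine ⟨k, hk.2, fun i hi => ?_⟩
    by_cases hij : ‖c i‖ < ‖c j‖
    · exact hij.le.trans (hmax j (by simp [hj]))
    · exact hmax i (by simp [hi, not_lt.1 hij])
  · push Not at h
    obtain ⟨j, hj⟩ := Infinite.exists_notMem_finset F
    exact ⟨j, hj, fun i hi => by rw [h i hi, h j hj]⟩

theorem IsDiagonal.singularValue_le [Infinite ι] (hT : IsDiagonal b T c) (F : Finset ι) {C : ℝ}
    (hC : 0 ≤ C) (h : ∀ i ∉ F, ‖c i‖ ≤ C) : singularValue T F.card ≤ C := by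
  classical
  have : FiniteDimensional ℂ (Submodule.span ℂ (F.image b : Set H)) :=
    FiniteDimensional.span_finset ℂ _
  refine _root_.singularValue_le b.not_finiteDimensional T _ (Submodule.span ℂ (F.image b : Set H))
    ((finrank_span_finset_le_card _).trans Finset.card_image_le) hC fun x hx => ?_
  refine hT.norm_apply_le hC fun i => ?_
  by_cases hi : i ∈ F
  · exact Or.inr (hx _ (Submodule.subset_span (by
      rw [Finset.coe_image]; exact Set.mem_image_of_mem _ hi)))
  · exact Or.inl (h i hi)

/-- Greedy choice: the next index has the largest remaining `‖c j‖`, and this bounds the next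
singular value. Together with `IsDiagonal.sum_norm_le_sum_singularValue`, it identifies the sum of
the first `N` singular values with the largest sum of `N` moduli of eigenvalues. -/
theorem IsDiagonal.exists_sum_singularValue_le [Infinite ι] (hT : IsDiagonal b T c)
    (hc : Tendsto c cofinite (𝓝 0)) (N : ℕ) :
    ∃ F : Finset ι, F.card = N ∧ ∑ n ∈ Finset.range N, singularValue T n ≤ ∑ i ∈ F, ‖c i‖ := by
  classical
  induction N with
  | zero => exact ⟨∅, by simp⟩
  | succ N ih =>
    obtain ⟨F, hF, hle⟩ := ih
    obtain ⟨j, hj, hmax⟩ := exists_forall_notMem_norm_le hc F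
    refine ⟨insert j F, by rw [Finset.card_insert_of_notMem hj, hF], ?_⟩
    rw [Finset.sum_range_succ, Finset.sum_insert hj, add_comm]
    exact add_le_add (hF ▸ hT.singularValue_le F (norm_nonneg _) hmax) hle

theorem IsDiagonal.sum_norm_le_sum_singularValue [Infinite ι] (hT : IsDiagonal b T c)
    (F : Finset ι) : ∑ i ∈ F, ‖c i‖ ≤ ∑ n ∈ Finset.range F.card, singularValue T n := by
  classical
  -- The phases of the eigenvalues: with `a i • b i` on the left, Ky Fan's inequality sees `‖c i‖`
  -- in place of `c i`.
  let a : ι → ℂ := fun i => if c i = 0 then 1 else c i / ‖c i‖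
  have ha : ∀ i, ‖a i‖ = 1 := fun i => by
    by_cases h : c i = 0
    · simp [a, h]
    · simp [a, h]
  have hac : ∀ i, (starRingEnd ℂ) (a i) * c i = ‖c i‖ := fun i => by
    by_cases h : c i = 0
    · simp [a, h]
    · have h' : (‖c i‖ : ℂ) ≠ 0 := by simpa using h
      simp only [a, h, if_false, map_div₀, Complex.conj_ofReal]
      rw [div_mul_eq_mul_div, Complex.conj_mul']
      field_simp
  have he : Orthonormal ℂ (fun i : F => b i) := b.orthonormal.comp _ Subtype.val_injective
  have hu : Orthonormal ℂ (fun i : F => a i • b i) := by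
    rw [orthonormal_iff_ite] at he ⊢
    intro i j
    rw [inner_smul_left, inner_smul_right, he]
    split_ifs with h
    · rw [h, mul_one, Complex.conj_mul', ha]; simp
    · simp
  have h := norm_sum_inner_le_sum_singularValue b.not_finiteDimensional T hu he
  rw [Fintype.card_coe] at h
  refine le_trans (le_of_eq ?_) h
  have : ∀ i : F, ⟪a i • b i, T (b i)⟫_ℂ = (‖c i‖ : ℂ) := fun i => by
    rw [inner_smul_left, hT, inner_self_eq_norm_sq_to_K, b.orthonormal.1]
    simpa using hac i
  rw [Finset.sum_congr rfl fun i _ => this i, ← Complex.ofReal_sum, Complex.norm_real,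
    Real.norm_of_nonneg (Finset.sum_nonneg fun _ _ => norm_nonneg _),
    Finset.sum_coe_sort F (fun i => ‖c i‖)]

theorem IsDiagonal.isPositive [CompleteSpace H] (hT : IsDiagonal b T c) (hc : ∀ i, 0 ≤ c i) :
    T.IsPositive := by
  rw [ContinuousLinearMap.isPositive_def']
  constructor
  · rw [ContinuousLinearMap.isSelfAdjoint_iff']
    refine (hT.adjoint.congr fun i => Complex.conj_eq_iff_im.2 ?_).unique hT
    exact (Complex.le_def.1 (hc i)).2.symm
  · intro x
    have h := b.hasSum_inner_mul_inner x (T x)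
    have h0 : 0 ≤ ⟪x, T x⟫_ℂ := by
      refine h.nonneg fun i => ?_
      rw [hT, mul_left_comm, ← inner_conj_symm x (b i), Complex.conj_mul']
      have := hc i
      positivity
    rw [ContinuousLinearMap.reApplyInnerSelf_apply, inner_re_symm]
    exact (Complex.le_def.1 h0).1

/-- A decomposition into a difference of positive operators with product zero is unique, so the
parts given by the functional calculus are the diagonal ones. -/
theorem IsDiagonal.posPart_negPart [CompleteSpace H] {r : ι → ℝ}
    (hT : IsDiagonal b T (fun i => (r i : ℂ))) {C : ℝ} (hC : ∀ i, |r i| ≤ C) :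
    IsDiagonal b T⁺ (fun i => ((r i)⁺ : ℝ)) ∧ IsDiagonal b T⁻ (fun i => ((r i)⁻ : ℝ)) := by
  obtain ⟨P, hP⟩ := exists_isDiagonal b (fun i => (((r i)⁺ : ℝ) : ℂ)) (C := C) fun i => by
    rw [Complex.norm_real, Real.norm_of_nonneg (posPart_nonneg _)]
    exact (sup_le (le_abs_self _) (abs_nonneg _)).trans (hC i)
  obtain ⟨N, hN⟩ := exists_isDiagonal b (fun i => (((r i)⁻ : ℝ) : ℂ)) (C := C) fun i => by
    rw [Complex.norm_real, Real.norm_of_nonneg (negPart_nonneg _)]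
    exact (sup_le (neg_le_abs _) (abs_nonneg _)).trans (hC i)
  have h := CFC.posPart_negPart_unique (a := T) (b := P) (c := N) ?_ ?_ ?_ ?_
  · rw [h.1, h.2]
    exact ⟨hP, hN⟩
  · refine hT.unique ((hP.sub hN).congr fun i => ?_)
    rw [← Complex.ofReal_sub, posPart_sub_negPart]
  · refine ((hP.comp hN).congr (d := 0) fun i => ?_).unique fun x i => by simp
    have : (r i)⁺ * (r i)⁻ = 0 := by
      rcases le_total 0 (r i) with h | h
      · rw [negPart_of_nonneg h, mul_zero]
      · rw [posPart_of_nonpos h, zero_mul]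
    rw [← Complex.ofReal_mul, this, Complex.ofReal_zero, Pi.zero_apply]
  · rw [ContinuousLinearMap.nonneg_iff_isPositive]
    exact hP.isPositive fun i => by simp
  · rw [ContinuousLinearMap.nonneg_iff_isPositive]
    exact hN.isPositive fun i => by simp

theorem IsDiagonal.realPart [CompleteSpace H] (hT : IsDiagonal b T c) :
    IsDiagonal b (ℜ T : H →L[ℂ] H) (fun i => ((c i).re : ℂ)) := by
  rw [realPart_apply_coe, ← Complex.coe_smul, ContinuousLinearMap.star_eq_adjoint]
  refine ((hT.add hT.adjoint).smul _).congr fun i => ?_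
  rw [Complex.add_conj]
  push_cast
  ring

theorem IsDiagonal.imaginaryPart [CompleteSpace H] (hT : IsDiagonal b T c) :
    IsDiagonal b (ℑ T : H →L[ℂ] H) (fun i => ((c i).im : ℂ)) := by
  rw [imaginaryPart_apply_coe, ← Complex.coe_smul, ContinuousLinearMap.star_eq_adjoint]
  refine (((hT.sub hT.adjoint).smul _).smul _).congr fun i => ?_
  rw [Complex.sub_conj]
  push_cast
  linear_combination (-(c i).im : ℂ) * Complex.I_mul_I

end Diagonal

/-! ### Two-sided estimates of `dixmierSigma` for diagonal operators. -/

section Dixmier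

variable {H : Type*} [NormedAddCommGroup H] [InnerProductSpace ℂ H] {ι : Type*}
  {b : HilbertBasis ι ℂ H} {T : H →L[ℂ] H} {l : ι → ℝ}

/-- The competitor cuts the eigenvalues at height `δ`: `R` keeps the excess `(l i - δ)⁺`, and `T -
R` has the eigenvalues `min (l i) δ`. -/
theorem IsDiagonal.iInf_le [CompleteSpace H] [Infinite ι]
    (hT : IsDiagonal b T (fun i => (l i : ℂ))) (h0 : ∀ i, 0 ≤ l i)
    (hl : Tendsto (fun i => (l i : ℂ)) cofinite (𝓝 0)) {δ B s : ℝ} (hδ : 0 ≤ δ) (hs : 0 ≤ s)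
    (hB : ∀ F : Finset ι, ∑ i ∈ F, (l i - δ)⁺ ≤ B) :
    (⨅ (R : H →L[ℂ] H) (S : H →L[ℂ] H) (_ : IsCompactOperator R) (_ : IsCompactOperator S)
      (_ : R + S = T), traceNorm R + ENNReal.ofReal (s * ‖S‖)) ≤ ENNReal.ofReal (B + s * δ) := by
  have hB0 : 0 ≤ B := by simpa using hB ∅
  have hp : ∀ i, (l i - δ)⁺ ≤ l i := fun i => sup_le (by linarith) (h0 i)
  have hn : ∀ i, ‖(((l i - δ)⁺ : ℝ) : ℂ)‖ = (l i - δ)⁺ := fun i => by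
    rw [Complex.norm_real, Real.norm_of_nonneg (posPart_nonneg _)]
  obtain ⟨R, hR⟩ := exists_isDiagonal b (fun i => (((l i - δ)⁺ : ℝ) : ℂ)) (C := B) fun i => by
    rw [hn]
    simpa using hB {i}
  have hlR : Tendsto (fun i => (((l i - δ)⁺ : ℝ) : ℂ)) cofinite (𝓝 0) := by
    refine squeeze_zero_norm (fun i => ?_) (tendsto_zero_iff_norm_tendsto_zero.1 hl)
    rw [hn, Complex.norm_real, Real.norm_of_nonneg (h0 i)]
    exact hp i
  have hRc := hR.isCompactOperator hlR
  refine iInf_le_of_le R (iInf_le_of_le (T - R) (iInf_le_of_le hRc (iInf_le_of_le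
    ((hT.isCompactOperator hl).sub hRc) (iInf_le_of_le (by abel) ?_))))
  rw [ENNReal.ofReal_add hB0 (by positivity)]
  refine add_le_add (traceNorm_le_of_sum_le R fun N => ?_) (ENNReal.ofReal_le_ofReal ?_)
  · obtain ⟨F, -, hF⟩ := hR.exists_sum_singularValue_le hlR N
    refine hF.trans ?_
    simp_rw [hn]
    exact hB F
  · refine mul_le_mul_of_nonneg_left ((hT.sub hR).norm_le hδ fun i => ?_) hs
    rw [← Complex.ofReal_sub, Complex.norm_real, Real.norm_of_nonneg (by linarith [hp i])]
    linarith [le_posPart (l i - δ)]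

/-- For any splitting `R + S`, the diagonal sum over `F` is at most `‖R‖₁` by Ky Fan plus `F.card *
‖S‖`, and `F.card ≤ s`. -/
theorem IsDiagonal.ofReal_sum_le_iInf [Infinite ι]
    (hT : IsDiagonal b T (fun i => (l i : ℂ))) (F : Finset ι) {s : ℝ} (hs : (F.card : ℝ) ≤ s) :
    ENNReal.ofReal (∑ i ∈ F, l i) ≤ ⨅ (R : H →L[ℂ] H) (S : H →L[ℂ] H)
      (_ : IsCompactOperator R) (_ : IsCompactOperator S) (_ : R + S = T),
        traceNorm R + ENNReal.ofReal (s * ‖S‖) := by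
  simp only [le_iInf_iff]
  rintro R S - - rfl
  refine le_trans ?_ (add_le_add_left (sum_singularValue_le_traceNorm R F.card) _)
  have hs0 : (0 : ℝ) ≤ s := le_trans (by positivity) hs
  rw [← ENNReal.ofReal_add (Finset.sum_nonneg fun _ _ => singularValue_nonneg _ _) (by positivity)]
  refine ENNReal.ofReal_le_ofReal ?_
  have he : Orthonormal ℂ (fun i : F => b i) := b.orthonormal.comp _ Subtype.val_injective
  have hR := norm_sum_inner_le_sum_singularValue b.not_finiteDimensional R he he
  rw [Fintype.card_coe] at hR
  have hS : ‖∑ i : F, ⟪b i, S (b i)⟫_ℂ‖ ≤ s * ‖S‖ := by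
    calc _ ≤ ∑ i : F, ‖⟪b i, S (b i)⟫_ℂ‖ := norm_sum_le _ _
      _ ≤ ∑ i : F, ‖S‖ := Finset.sum_le_sum fun i _ => by
          refine (norm_inner_le_norm _ _).trans ?_
          rw [b.orthonormal.1, one_mul]
          simpa [b.orthonormal.1] using S.le_opNorm (b i)
      _ = F.card * ‖S‖ := by simp
      _ ≤ _ := by gcongr
  have hsum : ((∑ i ∈ F, l i : ℝ) : ℂ) = (∑ i : F, ⟪b i, R (b i)⟫_ℂ) +
      ∑ i : F, ⟪b i, S (b i)⟫_ℂ := by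
    rw [← Finset.sum_add_distrib, ← Finset.sum_coe_sort F l, Complex.ofReal_sum]
    refine Finset.sum_congr rfl fun i _ => ?_
    rw [← inner_add_right, ← add_apply, hT, inner_self_eq_norm_sq_to_K, b.orthonormal.1]
    simp
  calc ∑ i ∈ F, l i ≤ ‖((∑ i ∈ F, l i : ℝ) : ℂ)‖ := by
        rw [Complex.norm_real]; exact le_abs_self _
    _ ≤ _ := by
        rw [hsum]
        exact (norm_add_le _ _).trans (add_le_add hR hS)

/-- The bounds are asymmetric because the lower estimates use only finitely many rows: they reach
every `q < P`, with a constant depending on `q`. -/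
theorem tendsto_div_of_linear_bounds {α : Type*} {u : Filter α} {f L : α → ℝ} {P : ℝ}
    (hL : Tendsto L u atTop)
    (hlow : ∀ q < P, ∃ C, ∀ᶠ s in u, q * L s - C ≤ f s)
    (hup : ∃ C, ∀ᶠ s in u, f s ≤ P * L s + C) : Tendsto (fun s => f s / L s) u (𝓝 P) := by
  have hC : ∀ C : ℝ, Tendsto (fun s => C / L s) u (𝓝 0) := fun C => hL.const_div_atTop C
  refine tendsto_order.2 ⟨fun q hq => ?_, fun q hq => ?_⟩
  · obtain ⟨q', hq', hq'P⟩ := exists_between hq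
    obtain ⟨C, hCf⟩ := hlow q' hq'P
    filter_upwards [hCf, hL.eventually_gt_atTop 0,
      (hC C).eventually (gt_mem_nhds (sub_pos.2 hq'))] with s h1 h2 h3
    rw [lt_div_iff₀ h2]
    rw [div_lt_iff₀ h2] at h3
    linarith
  · obtain ⟨C, hCf⟩ := hup
    filter_upwards [hCf, hL.eventually_gt_atTop 0,
      (hC C).eventually (gt_mem_nhds (sub_pos.2 hq))] with s h1 h2 h3
    rw [div_lt_iff₀ h2]
    rw [div_lt_iff₀ h2] at h3
    linarith

theorem log_sub_log_le_sum_inv {c : ℝ} (hc : 0 < c) (M : ℕ) :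
    Real.log (M + c) - Real.log c ≤ ∑ m ∈ Finset.range M, 1 / ((m : ℝ) + c) := by
  induction M with
  | zero => simp
  | succ M ih =>
    rw [Finset.sum_range_succ]
    have h1 : 0 < (M : ℝ) + c := by positivity
    have h2 := Real.log_le_sub_one_of_pos (x := (M + 1 + c) / (M + c)) (by positivity)
    rw [Real.log_div (by positivity) (by positivity)] at h2
    have h3 : ((M : ℝ) + 1 + c) / (M + c) - 1 = 1 / (M + c) := by
      field_simp; ring
    push_cast
    linarith

/-! ### Sums of the double family `p n / (n + m + a)`. -/

section Weights

variable {p : ℕ → ℝ} {a : ℝ}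

/-- The set is a rectangle of `K` rows and `⌊s / K⌋` columns. In each row the denominators are at
most `m + (K + a)`, so the harmonic sum is `log s` up to a constant depending on `K` and `a`. -/
theorem exists_sum_div_ge (hp : ∀ n, 0 ≤ p n) (ha : 0 < a) {K : ℕ} (hK : 0 < K) {s : ℝ}
    (hs : 2 * K ≤ s) : ∃ F : Finset (ℕ × ℕ), (F.card : ℝ) ≤ s ∧
      (∑ n ∈ Finset.range K, p n) * (Real.log s - Real.log (2 * K) - Real.log (K + a)) ≤
        ∑ i ∈ F, p i.1 / ((i.1 : ℝ) + i.2 + a) := by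
  have hK' : (0 : ℝ) < K := by exact_mod_cast hK
  set M := ⌊s / K⌋₊ with hM
  have hs0 : 0 < s := by linarith
  have hM1 : (M : ℝ) ≤ s / K := Nat.floor_le (by positivity)
  -- Since `s / K ≥ 2`, rounding down loses at most half.
  have hM2 : s / (2 * K) ≤ M := by
    have h1 : s / K < M + 1 := Nat.lt_floor_add_one _
    have h2 : 1 ≤ s / (2 * K) := by rw [le_div_iff₀ (by positivity)]; linarith
    have h3 : s / K = s / (2 * K) + s / (2 * K) := by field_simp; ring
    linarith
  refine ⟨Finset.range K ×ˢ Finset.range M, ?_, ?_⟩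
  · rw [Finset.card_product, Finset.card_range, Finset.card_range]
    push_cast
    rw [le_div_iff₀ hK'] at hM1
    linarith
  · rw [Finset.sum_product, Finset.sum_mul]
    refine Finset.sum_le_sum fun n hn => ?_
    have hnK : (n : ℝ) ≤ K := by exact_mod_cast (Finset.mem_range.1 hn).le
    have h1 : Real.log s - Real.log (2 * K) - Real.log (K + a) ≤
        ∑ m ∈ Finset.range M, 1 / ((m : ℝ) + (K + a)) := by
      refine le_trans ?_ (log_sub_log_le_sum_inv (by positivity) M)
      rw [← Real.log_div (by positivity) (by positivity)]
      refine sub_le_sub_right (Real.log_le_log (by positivity) ?_) _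
      linarith
    refine (mul_le_mul_of_nonneg_left h1 (hp n)).trans ?_
    rw [Finset.mul_sum]
    refine Finset.sum_le_sum fun m _ => ?_
    rw [mul_one_div]
    refine div_le_div_of_nonneg_left (hp n) (by positivity) ?_
    simp only
    linarith

/-- As `a ≥ 1`, the term at `(n, m)` is at most `p n / (m + 1)`, so it survives the cut at `1 / s`
only when `m + 1 < s * p n`. Each row is thus bounded by `p n` times a harmonic number of order `s *
P`, and the row bounds are summed. -/
theorem sum_posPart_div_sub_le (hp : ∀ n, 0 ≤ p n) (hps : Summable p) (ha : 1 ≤ a) {s : ℝ}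
    (hs : 1 ≤ s) (F : Finset (ℕ × ℕ)) :
    ∑ i ∈ F, (p i.1 / ((i.1 : ℝ) + i.2 + a) - 1 / s)⁺ ≤
      (∑' n, p n) * (1 + Real.log s + Real.log (max (∑' n, p n) 1)) := by
  classical
  set P := ∑' n, p n with hP
  -- The maximum with one gives `s * P' ≥ 1`, as the logarithmic bound on harmonic numbers requires.
  set P' := max P 1 with hP'
  have hP'1 : 1 ≤ P' := le_max_right _ _
  have hs0 : 0 < s := by linarith
  set y := s * P' with hy
  have hy1 : 1 ≤ y := one_le_mul_of_one_le_of_one_le hs hP'1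
  have hlog : 1 + Real.log s + Real.log P' = 1 + Real.log y := by
    rw [hy, Real.log_mul (by positivity) (by positivity)]
    ring
  have hrow : ∀ n, ∀ G : Finset ℕ,
      ∑ m ∈ G, (p n / ((n : ℝ) + m + a) - 1 / s)⁺ ≤ p n * (1 + Real.log y) := by
    intro n G
    have hpn : p n ≤ P' := (hps.le_tsum n fun j _ => hp j).trans (le_max_left _ _)
    have hle : ∀ m : ℕ, p n / ((n : ℝ) + m + a) ≤ p n * ((m + 1 : ℕ) : ℝ)⁻¹ := fun m => by
      rw [← div_eq_mul_inv]
      have := hp n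
      gcongr
      push_cast
      linarith [Nat.cast_nonneg (α := ℝ) n]
    calc _ ≤ ∑ m ∈ G, if m < ⌊y⌋₊ then p n * ((m + 1 : ℕ) : ℝ)⁻¹ else 0 := by
          refine Finset.sum_le_sum fun m _ => ?_
          split_ifs with hm
          · refine sup_le ?_ (mul_nonneg (hp n) (by positivity))
            have : 0 < 1 / s := by positivity
            linarith [hle m]
          · refine sup_le ?_ le_rfl
            have h1 : y < (m : ℝ) + 1 := by
              have := Nat.lt_floor_add_one y
              have h2 : (⌊y⌋₊ : ℝ) ≤ m := by exact_mod_cast not_lt.1 hm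
              linarith
            rw [sub_nonpos]
            refine (hle m).trans ?_
            push_cast
            rw [← div_eq_mul_inv, div_le_div_iff₀ (by positivity) hs0]
            nlinarith
      _ = ∑ m ∈ G.filter (· < ⌊y⌋₊), p n * ((m + 1 : ℕ) : ℝ)⁻¹ := by rw [Finset.sum_filter]
      _ ≤ ∑ m ∈ Finset.range ⌊y⌋₊, p n * ((m + 1 : ℕ) : ℝ)⁻¹ :=
          Finset.sum_le_sum_of_subset_of_nonneg
            (fun m hm => Finset.mem_range.2 (Finset.mem_filter.1 hm).2)
            fun m _ _ => mul_nonneg (hp n) (by positivity)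
      _ = p n * (harmonic ⌊y⌋₊ : ℝ) := by
          rw [← Finset.mul_sum, harmonic]
          push_cast
          rfl
      _ ≤ _ := mul_le_mul_of_nonneg_left (harmonic_floor_le_one_add_log y hy1) (hp n)
  rw [hlog]
  calc _ ≤ ∑ i ∈ F.image Prod.fst ×ˢ F.image Prod.snd,
        (p i.1 / ((i.1 : ℝ) + i.2 + a) - 1 / s)⁺ :=
      Finset.sum_le_sum_of_subset_of_nonneg Finset.subset_product fun _ _ _ => posPart_nonneg _
    _ ≤ ∑ n ∈ F.image Prod.fst, p n * (1 + Real.log y) := by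
      rw [Finset.sum_product]
      exact Finset.sum_le_sum fun n _ => hrow n _
    _ ≤ _ := by
      rw [← Finset.sum_mul]
      refine mul_le_mul_of_nonneg_right (hps.sum_le_tsum _ fun n _ => hp n) ?_
      linarith [Real.log_nonneg hy1]

theorem tendsto_div_weights {t : ℕ → ℂ} (ht : Summable fun n => ‖t n‖) (ha : 1 ≤ a) :
    Tendsto (fun i : ℕ × ℕ => t i.1 / (((i.1 : ℝ) + i.2 + a : ℝ) : ℂ)) cofinite (𝓝 0) := by
  rw [tendsto_zero_iff_norm_tendsto_zero]
  refine (tendsto_order.2 ⟨fun q hq => Eventually.of_forall fun i =>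
    hq.trans_le (norm_nonneg _), fun q hq => ?_⟩)
  set P := ∑' n, ‖t n‖
  have hPn : ∀ n, ‖t n‖ ≤ P := fun n => ht.le_tsum n fun j _ => norm_nonneg _
  obtain ⟨N, hN⟩ := exists_nat_gt (P / q)
  have hsub : {i : ℕ × ℕ | ¬ ‖t i.1 / (((i.1 : ℝ) + i.2 + a : ℝ) : ℂ)‖ < q} ⊆
      (Finset.range N ×ˢ Finset.range N : Finset (ℕ × ℕ)) := by
    rintro ⟨n, m⟩ h
    simp only [Set.mem_ofPred_eq, not_lt, norm_div, Complex.norm_real] at h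
    have h0 : (0 : ℝ) < n + m + a := by positivity
    rw [Real.norm_of_nonneg h0.le, le_div_iff₀ h0] at h
    rw [div_lt_iff₀ hq] at hN
    have h1 : (n : ℝ) + m + a < N := by
      by_contra! h2
      have := hPn n
      nlinarith
    have h2 : n + m < N := by
      have : (n : ℝ) + m < N := by linarith
      exact_mod_cast this
    simp only [Finset.coe_product, Finset.coe_range, Set.mem_prod, Set.mem_Iio]
    omega
  exact (Finset.finite_toSet _).subset hsub

end Weights

end Dixmier

/-! ### Logarithmic means and states at infinity. -/

section Cesaro

variable {g : ℝ → ℝ} {r₀ P : ℝ}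

theorem tendsto_log_mean (hr₀ : 1 < r₀) (hg : ∀ x y, IntervalIntegrable (fun s => g s / s) volume x y)
    (hP : Tendsto g atTop (𝓝 P)) :
    Tendsto (fun r => (1 / Real.log r) * ∫ s in r₀..r, g s / s) atTop (𝓝 P) := by
  rw [Metric.tendsto_atTop] at hP
  have hlog := Real.tendsto_log_atTop
  rw [Metric.tendsto_atTop]
  intro ε hε
  obtain ⟨r₁, hr₁⟩ := hP (ε / 2) (half_pos hε)
  set ρ := max r₀ r₁ with hρ
  have hρ0 : 1 < ρ := hr₀.trans_le (le_max_left _ _)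
  -- `A` collects the contributions fixed by `r₀` and `ρ`; dividing by `log r` removes them in the
  -- limit. Beyond `ρ` the integrand is within `ε / 2` of its limit.
  set A := |(∫ s in r₀..ρ, g s / s)| + |P| * Real.log ρ with hA
  have hev := (hlog.const_div_atTop A).eventually (gt_mem_nhds (half_pos hε))
  obtain ⟨r₂, hr₂⟩ := eventually_atTop.1 hev
  refine ⟨max ρ r₂, fun r hr => ?_⟩
  have hrρ : ρ ≤ r := (le_max_left _ _).trans hr
  have hr1 : 1 < r := hρ0.trans_le hrρ
  have hL : 0 < Real.log r := Real.log_pos hr1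
  have hAr := hr₂ r ((le_max_right _ _).trans hr)
  have hint : IntervalIntegrable (fun s : ℝ => P / s) volume ρ r := by
    simp_rw [div_eq_mul_inv]
    refine (intervalIntegral.intervalIntegrable_inv (fun x hx => ?_) continuousOn_id).const_mul P
    rw [Set.uIcc_of_le hrρ] at hx
    exact (by linarith [hx.1] : (0:ℝ) < x).ne'
  have hint' : IntervalIntegrable (fun s : ℝ => (ε / 2) / s) volume ρ r := by
    simp_rw [div_eq_mul_inv (ε / 2)]
    refine (intervalIntegral.intervalIntegrable_inv (fun x hx => ?_) continuousOn_id).const_mul _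
    rw [Set.uIcc_of_le hrρ] at hx
    exact (by linarith [hx.1] : (0:ℝ) < x).ne'
  have hPint : ∀ c : ℝ, ∫ s in ρ..r, c / s = c * (Real.log r - Real.log ρ) := fun c => by
    simp_rw [div_eq_mul_inv]
    rw [intervalIntegral.integral_const_mul, integral_inv_of_pos (by linarith) (by linarith),
      Real.log_div (by linarith) (by linarith)]
  have hmain : |(∫ s in ρ..r, g s / s) - P * (Real.log r - Real.log ρ)| ≤
      (ε / 2) * (Real.log r - Real.log ρ) := by
    rw [← hPint P, ← hPint (ε / 2), ← intervalIntegral.integral_sub (hg _ _) hint,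
      ← Real.norm_eq_abs]
    refine intervalIntegral.norm_integral_le_of_norm_le hrρ (ae_of_all _ fun s hs => ?_) hint'
    have hs0 : 0 < s := by linarith [hs.1]
    have := hr₁ s ((le_max_right _ _).trans hs.1.le)
    rw [← sub_div, norm_div, Real.norm_of_nonneg hs0.le]
    gcongr
    exact (by simpa [Real.dist_eq] using this.le)
  have hsplit : ∫ s in r₀..r, g s / s = (∫ s in r₀..ρ, g s / s) + ∫ s in ρ..r, g s / s :=
    (intervalIntegral.integral_add_adjacent_intervals (hg _ _) (hg _ _)).symm
  have hlogρ : 0 < Real.log ρ := Real.log_pos hρ0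
  rw [Real.dist_eq, hsplit]
  have heq : 1 / Real.log r * ((∫ s in r₀..ρ, g s / s) + ∫ s in ρ..r, g s / s) - P =
      ((∫ s in r₀..ρ, g s / s) - P * Real.log ρ +
        ((∫ s in ρ..r, g s / s) - P * (Real.log r - Real.log ρ))) / Real.log r := by
    field_simp
    ring
  rw [heq, abs_div, abs_of_pos hL, div_lt_iff₀ hL]
  rw [div_lt_iff₀ hL] at hAr
  have h1 := abs_add_le ((∫ s in r₀..ρ, g s / s) - P * Real.log ρ)
    ((∫ s in ρ..r, g s / s) - P * (Real.log r - Real.log ρ))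
  have h2 := abs_sub (∫ s in r₀..ρ, g s / s) (P * Real.log ρ)
  rw [abs_mul, abs_of_pos hlogρ] at h2
  nlinarith [mul_pos (half_pos hε) hlogρ]

theorem StateAtInfinity.apply_eq_of_tendsto (ω : StateAtInfinity r₀) (f : Set.Ici r₀ →ᵇ ℂ) {z : ℂ}
    (hf : Tendsto f atTop (𝓝 z)) : ω.toLinearMap f = z := by
  have h1 : ω.toLinearMap (f - z • (1 : Set.Ici r₀ →ᵇ ℂ)) = 0 := by
    refine ω.map_vanishing _ ?_
    have h := hf.sub_const z
    rw [sub_self] at h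
    exact h.congr fun x => by simp
  rw [map_sub, map_smul, ω.map_one, sub_eq_zero] at h1
  simpa using h1

variable {H : Type*} [NormedAddCommGroup H] [InnerProductSpace ℂ H]

/-- Monotonicity supplies the local integrability of `dixmierSigma` in `s`. The mean is then
continuous and convergent, hence bounded, and a state at infinity evaluates it to its limit. -/
theorem hasDixmierTraceOfPos_of_tendsto {T : H →L[ℂ] H} (hr₀ : 1 < r₀) (ω : StateAtInfinity r₀)
    (hmono : MonotoneOn (fun s => dixmierSigma s T) (Set.Ici 0))
    (hP : Tendsto (fun s => dixmierSigma s T / Real.log s) atTop (𝓝 P)) :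
    HasDixmierTraceOfPos ω T P := by
  -- Freezing the argument below `r₀` avoids the singularities of `1 / (s log s)` at `0` and `1`.
  -- The final factor `s` cancels in `g s / s`.
  let g : ℝ → ℝ := fun s => dixmierSigma (max s r₀) T / Real.log (max s r₀) / max s r₀ * s
  have hgs : ∀ s, r₀ ≤ s → g s / s = dixmierSigma s T / Real.log s / s := fun s hs => by
    have : s ≠ 0 := by linarith
    simp only [g, max_eq_left hs]
    field_simp
  have hg' : ∀ x y, IntervalIntegrable
      (fun s => dixmierSigma (max s r₀) T / Real.log (max s r₀) / max s r₀) volume x y := by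
    intro x y
    have hm : Monotone fun s => dixmierSigma (max s r₀) T := fun s s' h => by
      have h0 : ∀ x : ℝ, max x r₀ ∈ Set.Ici (0 : ℝ) := fun x =>
        (by linarith : (0 : ℝ) ≤ r₀).trans (le_max_right _ _)
      exact hmono (h0 s) (h0 s') (max_le_max_right r₀ h)
    have h1 : ∀ s : ℝ, 1 < max s r₀ := fun s => hr₀.trans_le (le_max_right _ _)
    have hc : Continuous fun s : ℝ => (Real.log (max s r₀))⁻¹ * (max s r₀)⁻¹ := by
      refine Continuous.mul (Continuous.inv₀ (Continuous.log (by fun_prop) fun s => ?_)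
        fun s => (Real.log_pos (h1 s)).ne') (Continuous.inv₀ (by fun_prop) fun s => ?_)
      all_goals linarith [h1 s]
    simp_rw [div_eq_mul_inv, mul_assoc]
    exact (hm.intervalIntegrable).mul_continuousOn hc.continuousOn
  have hg : ∀ x y, IntervalIntegrable (fun s => g s / s) volume x y := by
    intro x y
    refine (hg' x y).congr_ae ?_
    have : ∀ᵐ s : ℝ ∂(volume.restrict (Set.uIoc x y)), s ≠ 0 :=
      ae_restrict_of_ae (Measure.ae_ne volume 0)
    filter_upwards [this] with s hs
    simp only [g]
    field_simp
  have hτ : ∀ r, r₀ ≤ r → dixmierTau r₀ r T = 1 / Real.log r * ∫ s in r₀..r, g s / s := by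
    intro r hr
    rw [dixmierTau]
    congr 1
    refine intervalIntegral.integral_congr fun s hs => ?_
    rw [Set.uIcc_of_le hr] at hs
    exact (hgs s hs.1).symm
  have hgP : Tendsto g atTop (𝓝 P) := by
    refine hP.congr' ?_
    filter_upwards [eventually_ge_atTop r₀] with s hs
    have : s ≠ 0 := by linarith
    simp only [g, max_eq_left hs]
    field_simp
  have hlim := tendsto_log_mean hr₀ hg hgP
  set τ : ℝ → ℝ := fun r => 1 / Real.log r * ∫ s in r₀..r, g s / s with hτd
  have hcont : ContinuousOn τ (Set.Ici r₀) := by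
    refine ContinuousOn.mul (continuousOn_const.div (Real.continuousOn_log.mono fun x hx => ?_)
      fun x hx => ?_) (intervalIntegral.continuous_primitive hg r₀).continuousOn
    · have : r₀ ≤ x := hx
      simp only [Set.mem_compl_iff, Set.mem_singleton_iff]
      linarith
    · have : r₀ ≤ x := hx
      exact (Real.log_pos (by linarith)).ne'
  obtain ⟨C, hC⟩ : ∃ C, ∀ r, r₀ ≤ r → ‖τ r‖ ≤ C := by
    obtain ⟨r₁, hr₁⟩ := eventually_atTop.1 (hlim.norm.eventually (gt_mem_nhds (lt_add_one ‖P‖)))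
    obtain ⟨C, hC⟩ := (isCompact_Icc (a := r₀) (b := r₁)).exists_bound_of_continuousOn
      (hcont.mono fun x hx => hx.1)
    refine ⟨max C (‖P‖ + 1), fun r hr => ?_⟩
    rcases le_total r r₁ with h | h
    · exact (hC r ⟨hr, h⟩).trans (le_max_left _ _)
    · exact (hr₁ r h).le.trans (le_max_right _ _)
  let f : Set.Ici r₀ →ᵇ ℂ := BoundedContinuousFunction.ofNormedAddCommGroup
    (fun r : Set.Ici r₀ => ((τ r : ℝ) : ℂ))
    (Complex.continuous_ofReal.comp (continuousOn_iff_continuous_domRestrict.1 hcont)) C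
    fun r => by rw [Complex.norm_real]; exact hC r r.2
  refine ⟨f, fun r => ?_, ω.apply_eq_of_tendsto f ?_⟩
  · rw [hτ r r.2]
    rfl
  · exact (Complex.continuous_ofReal.tendsto P).comp (tendsto_comp_val_Ici_atTop.2 hlim)

end Cesaro

/-! ### Dixmier traces of the double family. -/

section DixmierDiagonal

variable {H : Type*} [NormedAddCommGroup H] [InnerProductSpace ℂ H]
  {b : HilbertBasis (ℕ × ℕ) ℂ H} {T : H →L[ℂ] H} {p : ℕ → ℝ} {a : ℝ}

/-- Finitely many rows already carry more than `q` of the total weight. -/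
theorem exists_lower_bound (hp : ∀ n, 0 ≤ p n) (hps : Summable p) (ha : 0 < a) {q : ℝ}
    (hq : q < ∑' n, p n) : ∃ C s₀ : ℝ, ∀ s, s₀ ≤ s → ∃ F : Finset (ℕ × ℕ), (F.card : ℝ) ≤ s ∧
      q * Real.log s - C ≤ ∑ i ∈ F, p i.1 / ((i.1 : ℝ) + i.2 + a) := by
  obtain ⟨K, hK0, hK⟩ := ((eventually_gt_atTop 0).and
    (hps.hasSum.tendsto_sum_nat.eventually (lt_mem_nhds hq))).exists
  set S := ∑ n ∈ Finset.range K, p n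
  refine ⟨S * (Real.log (2 * K) + Real.log (K + a)), max 1 (2 * K), fun s hs => ?_⟩
  obtain ⟨F, hF, h⟩ := exists_sum_div_ge hp ha hK0 ((le_max_right _ _).trans hs)
  refine ⟨F, hF, le_trans ?_ h⟩
  have hl : 0 ≤ Real.log s := Real.log_nonneg ((le_max_left _ _).trans hs)
  nlinarith [mul_le_mul_of_nonneg_right hK.le hl]

theorem IsDiagonal.tendsto_dixmierGamma {t : ℕ → ℂ} (ht : Summable fun n => ‖t n‖) (ha : 1 ≤ a)
    (hT : IsDiagonal b T (fun i => t i.1 / (((i.1 : ℝ) + i.2 + a : ℝ) : ℂ))) :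
    Tendsto (dixmierGamma T) atTop (𝓝 (∑' n, ‖t n‖)) := by
  have hc := tendsto_div_weights ht ha
  have hnorm : ∀ i : ℕ × ℕ, ‖t i.1 / (((i.1 : ℝ) + i.2 + a : ℝ) : ℂ)‖ =
      ‖t i.1‖ / ((i.1 : ℝ) + i.2 + a) := fun i => by
    rw [norm_div, Complex.norm_real, Real.norm_of_nonneg (by positivity)]
  have ha0 : 0 < a := by linarith
  refine tendsto_div_of_linear_bounds (L := fun N : ℕ => Real.log N)
    (Real.tendsto_log_atTop.comp tendsto_natCast_atTop_atTop) (fun q hq => ?_) ?_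
  · obtain ⟨C, s₀, h⟩ := exists_lower_bound (fun n => norm_nonneg (t n)) ht ha0 hq
    refine ⟨C, ?_⟩
    filter_upwards [tendsto_natCast_atTop_atTop.eventually_ge_atTop s₀] with N hN
    obtain ⟨F, hF, hle⟩ := h N hN
    refine hle.trans ?_
    have h1 := hT.sum_norm_le_sum_singularValue F
    simp_rw [hnorm] at h1
    refine h1.trans (Finset.sum_le_sum_of_subset_of_nonneg ?_ fun _ _ _ => singularValue_nonneg _ _)
    exact Finset.range_mono (by exact_mod_cast hF)
  · refine ⟨(∑' n, ‖t n‖) * (1 + Real.log (max (∑' n, ‖t n‖) 1)) + 1, ?_⟩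
    filter_upwards [eventually_ge_atTop 1] with N hN
    have hN' : (1 : ℝ) ≤ N := by exact_mod_cast hN
    obtain ⟨F, hF, hle⟩ := hT.exists_sum_singularValue_le hc N
    simp_rw [hnorm] at hle
    have h2 := sum_posPart_div_sub_le (fun n => norm_nonneg (t n)) ht ha hN' F
    -- Cutting at height `1 / N` costs at most one in total, as `F` has `N` elements.
    have h3 : ∑ i ∈ F, ‖t i.1‖ / ((i.1 : ℝ) + i.2 + a) ≤
        ∑ i ∈ F, ((‖t i.1‖ / ((i.1 : ℝ) + i.2 + a) - 1 / N)⁺ + 1 / N) :=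
      Finset.sum_le_sum fun i _ => by
        linarith [le_posPart (‖t i.1‖ / ((i.1 : ℝ) + i.2 + a) - 1 / N)]
    rw [Finset.sum_add_distrib, Finset.sum_const, hF, nsmul_eq_mul,
      mul_one_div_cancel (by positivity)] at h3
    linarith

theorem IsDiagonal.hasDixmierTraceOfPos [CompleteSpace H] (hp : ∀ n, 0 ≤ p n) (hps : Summable p) (ha : 1 ≤ a)
    (hT : IsDiagonal b T (fun i => ((p i.1 / ((i.1 : ℝ) + i.2 + a) : ℝ) : ℂ)))
    {r₀ : ℝ} (hr₀ : 1 < r₀) (ω : StateAtInfinity r₀) :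
    HasDixmierTraceOfPos ω T ((∑' n, p n : ℝ) : ℂ) := by
  have ha0 : 0 < a := by linarith
  have h0 : ∀ i : ℕ × ℕ, 0 ≤ p i.1 / ((i.1 : ℝ) + i.2 + a) := fun i => by
    have := hp i.1
    positivity
  have hl : Tendsto (fun i : ℕ × ℕ => ((p i.1 / ((i.1 : ℝ) + i.2 + a) : ℝ) : ℂ)) cofinite (𝓝 0) := by
    have := tendsto_div_weights (t := fun n => (p n : ℂ)) (a := a) (by simpa using hps.norm) ha
    refine this.congr fun i => ?_
    push_cast
    rfl
  -- The cut height `1 / s'` is kept free: `s' = 1` gives finiteness for all `s ≥ 0`, needed for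
  -- monotonicity of `toReal`, and `s' = s` gives the asymptotics.
  have hup : ∀ s : ℝ, 0 ≤ s → ∀ s' : ℝ, 1 ≤ s' → (⨅ (R : H →L[ℂ] H) (S : H →L[ℂ] H)
      (_ : IsCompactOperator R) (_ : IsCompactOperator S) (_ : R + S = T),
      traceNorm R + ENNReal.ofReal (s * ‖S‖)) ≤ ENNReal.ofReal
        ((∑' n, p n) * (1 + Real.log s' + Real.log (max (∑' n, p n) 1)) + s * (1 / s')) :=
    fun s hs s' hs' => hT.iInf_le h0 hl (by positivity) hs
      fun F => sum_posPart_div_sub_le hp hps ha hs' F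
  have hfin : ∀ s : ℝ, 0 ≤ s → (⨅ (R : H →L[ℂ] H) (S : H →L[ℂ] H)
      (_ : IsCompactOperator R) (_ : IsCompactOperator S) (_ : R + S = T),
      traceNorm R + ENNReal.ofReal (s * ‖S‖)) ≠ ∞ := fun s hs =>
    ne_top_of_le_ne_top ENNReal.ofReal_ne_top (hup s hs 1 le_rfl)
  refine hasDixmierTraceOfPos_of_tendsto hr₀ ω (fun s hs s' hs' hss' => ?_) ?_
  · refine ENNReal.toReal_mono (hfin s' hs') ?_
    gcongr
  · refine tendsto_div_of_linear_bounds Real.tendsto_log_atTop (fun q hq => ?_) ?_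
    · obtain ⟨C, s₀, h⟩ := exists_lower_bound hp hps ha0 hq
      refine ⟨C, ?_⟩
      filter_upwards [eventually_ge_atTop s₀, eventually_ge_atTop 0] with s hs hs0
      obtain ⟨F, hF, hle⟩ := h s hs
      refine hle.trans ?_
      rw [dixmierSigma, ← ENNReal.ofReal_le_iff_le_toReal (hfin s hs0)]
      exact hT.ofReal_sum_le_iInf F hF
    · refine ⟨(∑' n, p n) * (1 + Real.log (max (∑' n, p n) 1)) + 1, ?_⟩
      filter_upwards [eventually_ge_atTop 1] with s hs
      have hP : 0 ≤ ∑' n, p n := tsum_nonneg hp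
      have h1 := ENNReal.toReal_mono ENNReal.ofReal_ne_top (hup s (by linarith) s hs)
      have hls : 0 ≤ Real.log s := Real.log_nonneg hs
      have hlP : 0 ≤ Real.log (max (∑' n, p n) 1) := Real.log_nonneg (le_max_right _ _)
      rw [ENNReal.toReal_ofReal (by positivity), mul_one_div_cancel (by linarith)] at h1
      rw [dixmierSigma]
      linarith

theorem div_posPart {x y : ℝ} (hy : 0 < y) : (x / y)⁺ = x⁺ / y := by
  have h := max_div_div_right hy.le x 0
  rwa [zero_div] at h

theorem div_negPart {x y : ℝ} (hy : 0 < y) : (x / y)⁻ = x⁻ / y := by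
  rw [← posPart_neg, ← posPart_neg, ← neg_div, div_posPart hy]

/-- Measurability sees only moduli, so `dixmierGamma` tends to `∑ ‖t n‖`. The Dixmier trace itself
splits into the four positive parts, each again of the form `p n / (n + m + a)`, and the four sums
recombine to `∑ t n`. -/
theorem IsDiagonal.hasDixmierTrace [CompleteSpace H] {t : ℕ → ℂ} (ht : Summable fun n => ‖t n‖) (ha : 1 ≤ a)
    (hT : IsDiagonal b T (fun i => t i.1 / (((i.1 : ℝ) + i.2 + a : ℝ) : ℂ))) :
    HasDixmierTrace T (∑' n, t n) := by
  have hlim := hT.tendsto_dixmierGamma ht ha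
  have hideal : T ∈ dixmierIdeal H := by
    refine ⟨hT.isCompactOperator (tendsto_div_weights ht ha), ?_⟩
    obtain ⟨C, hC⟩ := hlim.bddAbove_range
    exact ⟨C, fun N _ => hC ⟨N, rfl⟩⟩
  refine ⟨⟨hideal, _, hlim⟩, fun r₀ hr₀ ω => ⟨hideal, ?_⟩⟩
  have hr₀' : 1 < r₀ := lt_trans (by simp) hr₀
  have hpos : ∀ i : ℕ × ℕ, (0 : ℝ) < (i.1 : ℝ) + i.2 + a := fun i => by positivity
  have key : ∀ (S : H →L[ℂ] H) (r : ℕ → ℝ), (∀ n, |r n| ≤ ‖t n‖) →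
      IsDiagonal b S (fun i => ((r i.1 / ((i.1 : ℝ) + i.2 + a) : ℝ) : ℂ)) →
      HasDixmierTraceOfPos ω S⁺ ((∑' n, (r n)⁺ : ℝ) : ℂ) ∧
      HasDixmierTraceOfPos ω S⁻ ((∑' n, (r n)⁻ : ℝ) : ℂ) ∧
      Summable (fun n => (r n)⁺) ∧ Summable (fun n => (r n)⁻) := by
    intro S r hr hS
    obtain ⟨h1, h2⟩ := hS.posPart_negPart (C := ∑' n, ‖t n‖) fun i => by
      rw [abs_div, abs_of_pos (hpos i), div_le_iff₀ (hpos i)]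
      have h3 := (hr i.1).trans (ht.le_tsum i.1 fun j _ => norm_nonneg _)
      have h4 : 1 ≤ (i.1 : ℝ) + i.2 + a := by
        have : (0 : ℝ) ≤ (i.1 : ℝ) + i.2 := by positivity
        linarith
      have h5 : 0 ≤ ∑' n, ‖t n‖ := tsum_nonneg fun _ => norm_nonneg _
      nlinarith
    simp_rw [div_posPart (hpos _)] at h1
    simp_rw [div_negPart (hpos _)] at h2
    have s1 : Summable (fun n => (r n)⁺) := ht.of_nonneg_of_le (fun n => posPart_nonneg _)
      fun n => (sup_le (le_abs_self _) (abs_nonneg _)).trans (hr n)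
    have s2 : Summable (fun n => (r n)⁻) := ht.of_nonneg_of_le (fun n => negPart_nonneg _)
      fun n => (sup_le (neg_le_abs _) (abs_nonneg _)).trans (hr n)
    exact ⟨h1.hasDixmierTraceOfPos (fun n => posPart_nonneg _) s1 ha hr₀' ω,
      h2.hasDixmierTraceOfPos (fun n => negPart_nonneg _) s2 ha hr₀' ω, s1, s2⟩
  obtain ⟨a1, a2, a3, a4⟩ := key _ (fun n => (t n).re) (fun n => Complex.abs_re_le_norm _)
    (hT.realPart.congr fun i => by rw [Complex.div_ofReal_re])
  obtain ⟨b1, b2, b3, b4⟩ := key _ (fun n => (t n).im) (fun n => Complex.abs_im_le_norm _)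
    (hT.imaginaryPart.congr fun i => by rw [Complex.div_ofReal_im])
  refine ⟨_, _, _, _, a1, a2, b1, b2, ?_⟩
  rw [← Complex.ofReal_sub, ← Complex.ofReal_sub, ← a3.tsum_sub a4, ← b3.tsum_sub b4]
  simp_rw [posPart_sub_negPart]
  have hts : Summable t := ht.of_norm
  rw [← Complex.re_tsum hts, ← Complex.im_tsum hts, mul_comm, Complex.re_add_im]

end DixmierDiagonal

/-! ### Hilbert–Schmidt operators and trace class compressions. -/

section TraceClass

variable {H : Type*} [NormedAddCommGroup H] [InnerProductSpace ℂ H]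

theorem singularValue_antitone (hH : ¬ FiniteDimensional ℂ H) (T : H →L[ℂ] H) {m n : ℕ}
    (h : m ≤ n) : singularValue T n ≤ singularValue T m := by
  refine le_of_forall_pos_le_add fun ε hε => ?_
  obtain ⟨V, hV, hVm, hVT⟩ := exists_norm_le_singularValue_add hH T m hε
  exact singularValue_le hH T n V (by omega) (by linarith [singularValue_nonneg T m]) hVT

/-- If `V` and `W` are nearly optimal for `A` and `B`, then `B* V + W` has dimension at most `m +
n`, and for `x` orthogonal to it both `x ⊥ W` and `B x ⊥ V` hold. -/
theorem singularValue_comp_le [CompleteSpace H] (hH : ¬ FiniteDimensional ℂ H) (A B : H →L[ℂ] H)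
    (m n : ℕ) : singularValue (A ∘L B) (m + n) ≤ singularValue A m * singularValue B n := by
  have hA := singularValue_nonneg A m
  have hB := singularValue_nonneg B n
  have key : ∀ ε > 0, singularValue (A ∘L B) (m + n) ≤
      (singularValue A m + ε) * (singularValue B n + ε) := fun ε hε => by
    obtain ⟨V, hV, hVm, hVA⟩ := exists_norm_le_singularValue_add hH A m hε
    obtain ⟨W, hW, hWn, hWB⟩ := exists_norm_le_singularValue_add hH B n hε
    let L : H →ₗ[ℂ] H := (ContinuousLinearMap.adjoint B).toLinearMap
    refine singularValue_le hH _ _ (V.map L ⊔ W) ?_ (by positivity) fun x hx => ?_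
    · refine (Submodule.finrank_add_le_finrank_add_finrank _ _).trans ?_
      rw [hWn, ← hVm]
      exact Nat.add_le_add_right (Submodule.finrank_map_le L V) _
    · have hxW : x ∈ Wᗮ := Submodule.orthogonal_le le_sup_right hx
      have hxV : B x ∈ Vᗮ := fun v hv => by
        rw [← ContinuousLinearMap.adjoint_inner_left]
        exact hx _ (Submodule.mem_sup_left (Submodule.mem_map_of_mem hv))
      calc ‖A (B x)‖ ≤ (singularValue A m + ε) * ‖B x‖ := hVA _ hxV
        _ ≤ (singularValue A m + ε) * ((singularValue B n + ε) * ‖x‖) := by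
            gcongr
            exact hWB x hxW
        _ = _ := by ring
  have hlim : Tendsto (fun ε : ℝ => (singularValue A m + ε) * (singularValue B n + ε)) (𝓝[>] 0)
      (𝓝 ((singularValue A m + 0) * (singularValue B n + 0))) :=
    tendsto_nhdsWithin_of_tendsto_nhds (Continuous.tendsto (by fun_prop) 0)
  simp only [add_zero] at hlim
  exact ge_of_tendsto hlim (eventually_nhdsWithin_of_forall key)

/-- On the complement of the first `N` vectors the norm of `A` is at least its `N`-th singular
value, so some unit vector there nearly attains it. Otherwise the span of these vectors would
witness a smaller singular value. -/
theorem exists_orthonormal_sq_singularValue_le (hH : ¬ FiniteDimensional ℂ H) (A : H →L[ℂ] H)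
    {ε : ℝ} (hε : 0 < ε) (N : ℕ) :
    ∃ f : Fin N → H, Orthonormal ℂ f ∧ ∀ n : Fin N, singularValue A n ^ 2 ≤ ‖A (f n)‖ ^ 2 + ε := by
  induction N with
  | zero => exact ⟨Fin.elim0, by simp [Orthonormal], fun i => i.elim0⟩
  | succ N ih =>
    obtain ⟨f, hf, hfA⟩ := ih
    have hV : FiniteDimensional ℂ (Submodule.span ℂ (Set.range f)) :=
      FiniteDimensional.span_of_finite ℂ (Set.finite_range f)
    have hVN : Module.finrank ℂ (Submodule.span ℂ (Set.range f)) = N := by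
      rw [finrank_span_eq_card hf.linearIndependent, Fintype.card_fin]
    obtain ⟨x, hxV, hx, hxA⟩ : ∃ x ∈ (Submodule.span ℂ (Set.range f))ᗮ, ‖x‖ = 1 ∧
        singularValue A N ^ 2 ≤ ‖A x‖ ^ 2 + ε := by
      by_contra! hcon
      obtain ⟨E, -, hE, hEN⟩ := (⊥ : Submodule ℂ H).exists_le_finrank_eq hH (N + 1) (by simp)
      obtain ⟨y, -, hyV, hy⟩ := E.exists_unit_mem_orthogonal _ (hVN.trans_lt (by omega))
      have h0 := hcon y hyV hy
      have hpos : 0 ≤ singularValue A N ^ 2 - ε := by nlinarith [sq_nonneg ‖A y‖]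
      have hle : singularValue A N ≤ √(singularValue A N ^ 2 - ε) := by
        refine singularValue_le hH A N _ hVN.le (Real.sqrt_nonneg _) fun x hx => ?_
        by_cases hx0 : x = 0
        · simp [hx0]
        have hn : ‖x‖ ≠ 0 := by simpa using hx0
        have hn' : 0 < ‖x‖ := by positivity
        have h1 := hcon (((‖x‖⁻¹ : ℝ) : ℂ) • x) (Submodule.smul_mem _ _ hx) (by
          rw [norm_smul, Complex.norm_real, norm_inv, norm_norm, inv_mul_cancel₀ hn])
        rw [map_smul, norm_smul, Complex.norm_real, norm_inv, norm_norm] at h1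
        have h2 : ‖x‖⁻¹ * ‖A x‖ ≤ √(singularValue A N ^ 2 - ε) :=
          Real.le_sqrt_of_sq_le (by linarith)
        rwa [inv_mul_le_iff₀ hn', mul_comm] at h2
      have h3 := Real.sq_sqrt hpos
      nlinarith [singularValue_nonneg A N, Real.sqrt_nonneg (singularValue A N ^ 2 - ε)]
    have hfx : ∀ i, ⟪f i, x⟫_ℂ = 0 := fun i => hxV _ (Submodule.subset_span ⟨i, rfl⟩)
    refine ⟨Fin.snoc f x, ?_, fun i => ?_⟩
    · rw [orthonormal_iff_ite] at hf ⊢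
      intro i j
      induction i using Fin.lastCases with
      | last =>
        induction j using Fin.lastCases with
        | last => simp [hx]
        | cast j => simp [← inner_conj_symm x (f j), hfx, (Fin.castSucc_lt_last j).ne']
      | cast i =>
        induction j using Fin.lastCases with
        | last => simp [hfx, (Fin.castSucc_lt_last i).ne]
        | cast j => simp [hf]
    · induction i using Fin.lastCases with
      | last => simpa using hxA
      | cast i => simpa using hfA i

variable [CompleteSpace H] {ι : Type*} (b : HilbertBasis ι ℂ H)

/-- Expand `∑ ‖A (f n)‖²` in the basis `b`, for `f` the nearly extremal vectors, and apply Bessel's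
inequality to each `A* (b i)`. -/
theorem sum_sq_singularValue_le [Infinite ι] (A : H →L[ℂ] H)
    (hA : Summable fun i => ‖ContinuousLinearMap.adjoint A (b i)‖ ^ 2) (N : ℕ) :
    ∑ n ∈ Finset.range N, singularValue A n ^ 2 ≤
      ∑' i, ‖ContinuousLinearMap.adjoint A (b i)‖ ^ 2 := by
  refine le_of_forall_pos_le_add fun δ hδ => ?_
  obtain ⟨f, hf, hfA⟩ := exists_orthonormal_sq_singularValue_le b.not_finiteDimensional A
    (ε := δ / (N + 1)) (by positivity) N
  have h1 : HasSum (fun i => ∑ n, ‖⟪b i, A (f n)⟫_ℂ‖ ^ 2) (∑ n, ‖A (f n)‖ ^ 2) :=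
    hasSum_sum fun n _ => b.hasSum_norm_inner_sq (A (f n))
  have h2 : ∑ n, ‖A (f n)‖ ^ 2 ≤ ∑' i, ‖ContinuousLinearMap.adjoint A (b i)‖ ^ 2 := by
    refine hasSum_le (fun i => ?_) h1 hA.hasSum
    refine le_trans (le_of_eq ?_)
      (hf.sum_inner_products_le (ContinuousLinearMap.adjoint A (b i)) (s := Finset.univ))
    refine Finset.sum_congr rfl fun n _ => ?_
    rw [← ContinuousLinearMap.adjoint_inner_left, norm_inner_symm]
  calc _ = ∑ n : Fin N, singularValue A n ^ 2 := by rw [Finset.sum_range]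
    _ ≤ ∑ n : Fin N, (‖A (f n)‖ ^ 2 + δ / (N + 1)) := Finset.sum_le_sum fun n _ => hfA n
    _ = (∑ n : Fin N, ‖A (f n)‖ ^ 2) + N * (δ / (N + 1)) := by
        rw [Finset.sum_add_distrib]; simp
    _ ≤ _ := by
        have : (N : ℝ) * (δ / (N + 1)) ≤ δ := by
          rw [mul_div_assoc', div_le_iff₀ (by positivity)]
          nlinarith
        linarith

theorem summable_norm_adjoint_sq (A : H →L[ℂ] H) (hA : Summable fun i => ‖A (b i)‖ ^ 2) :
    Summable fun i => ‖ContinuousLinearMap.adjoint A (b i)‖ ^ 2 := by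
  have h : Summable fun q : ι × ι => ‖⟪b q.2, A (b q.1)⟫_ℂ‖ ^ 2 := by
    rw [summable_prod_of_nonneg fun _ => by positivity]
    exact ⟨fun i => (b.hasSum_norm_inner_sq (A (b i))).summable,
      hA.congr fun i => (b.hasSum_norm_inner_sq (A (b i))).tsum_eq.symm⟩
  have h2 : Summable fun j => ∑' i, ‖⟪b j, A (b i)⟫_ℂ‖ ^ 2 := h.prod_symm.prod
  convert h2 using 2 with j
  rw [← (b.hasSum_norm_inner_sq (ContinuousLinearMap.adjoint A (b j))).tsum_eq]
  refine tsum_congr fun i => ?_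
  rw [ContinuousLinearMap.adjoint_inner_right, norm_inner_symm]

/-- Singular values of the product with indices `2M` and `2M + 1` are both at most `μ_M(A) μ_M(B)`,
so each such pair contributes at most `μ_M(A)² + μ_M(B)²`. -/
theorem traceNorm_comp_lt_top [Infinite ι] (A B : H →L[ℂ] H)
    (hA : Summable fun i => ‖A (b i)‖ ^ 2)
    (hB : Summable fun i => ‖ContinuousLinearMap.adjoint B (b i)‖ ^ 2) :
    traceNorm (A ∘L B) < ∞ := by
  have hH := b.not_finiteDimensional
  refine lt_of_le_of_lt (traceNorm_le_of_sum_le _ (C :=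
    (∑' i, ‖ContinuousLinearMap.adjoint A (b i)‖ ^ 2) +
      ∑' i, ‖ContinuousLinearMap.adjoint B (b i)‖ ^ 2) fun N => ?_) ENNReal.ofReal_lt_top
  have h1 : ∑ n ∈ Finset.range N, singularValue (A ∘L B) n ≤
      ∑ n ∈ Finset.range (2 * N), singularValue (A ∘L B) n :=
    Finset.sum_le_sum_of_subset_of_nonneg (Finset.range_mono (by omega))
      fun _ _ _ => singularValue_nonneg _ _
  have h2 : ∀ M, ∑ n ∈ Finset.range (2 * M), singularValue (A ∘L B) n ≤
      ∑ n ∈ Finset.range M, (singularValue A n ^ 2 + singularValue B n ^ 2) := by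
    intro M
    induction M with
    | zero => simp
    | succ M ih =>
      rw [show 2 * (M + 1) = 2 * M + 1 + 1 by ring, Finset.sum_range_succ, Finset.sum_range_succ,
        Finset.sum_range_succ _ M]
      have h3 := singularValue_comp_le hH A B M M
      rw [← two_mul] at h3
      have h4 := singularValue_antitone hH (A ∘L B) (Nat.le_succ (2 * M))
      rw [Nat.succ_eq_add_one] at h4
      nlinarith [sq_nonneg (singularValue A M - singularValue B M)]
  refine (h1.trans (h2 N)).trans ?_
  rw [Finset.sum_add_distrib]
  exact add_le_add (sum_sq_singularValue_le b A (summable_norm_adjoint_sq b A hA) N)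
    (sum_sq_singularValue_le b B hB N)

variable {b}

/-- Factoring `c = √‖c‖ * (c / √‖c‖)` writes the operator as a product of two Hilbert–Schmidt
operators. The zero eigenvalues cause no trouble since `0 / 0 = 0`. The trace follows by summing one
absolutely summable double family in the two orders. -/
theorem IsDiagonal.hasTrace_conj [Infinite ι] {T P : H →L[ℂ] H} {c : ι → ℂ}
    (hT : IsDiagonal b T c) (hP : ContinuousLinearMap.adjoint P = P) {C : ℝ}
    (hC : ∀ i, ‖c i‖ ≤ C) (hs : Summable fun i => ‖c i‖ * ‖P (b i)‖ ^ 2) :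
    HasTrace (P ∘L T ∘L P) (∑' i, c i * ((‖P (b i)‖ ^ 2 : ℝ) : ℂ)) := by
  constructor
  · have hbd : ∀ i, √‖c i‖ ≤ √C := fun i => Real.sqrt_le_sqrt (hC i)
    have hnorm : ∀ i, ‖c i / (√‖c i‖ : ℂ)‖ = √‖c i‖ := fun i => by
      rw [norm_div, Complex.norm_real, Real.norm_of_nonneg (Real.sqrt_nonneg _), Real.div_sqrt]
    obtain ⟨S, hS⟩ := exists_isDiagonal b (fun i => (√‖c i‖ : ℂ)) (C := √C) fun i => by
      rw [Complex.norm_real, Real.norm_of_nonneg (Real.sqrt_nonneg _)]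
      exact hbd i
    obtain ⟨R, hR⟩ := exists_isDiagonal b (fun i => c i / (√‖c i‖ : ℂ)) (C := √C) fun i => by
      rw [hnorm]
      exact hbd i
    have hSR : T = S ∘L R := by
      refine hT.unique ((hS.comp hR).congr fun i => ?_)
      by_cases h : c i = 0
      · simp [h]
      · have : (√‖c i‖ : ℂ) ≠ 0 := by simpa [Real.sqrt_eq_zero'] using h
        field_simp
    have hsplit : P ∘L T ∘L P = (P ∘L S) ∘L (R ∘L P) := by
      rw [hSR]; rfl
    rw [hsplit]
    refine traceNorm_comp_lt_top b _ _ (hs.congr fun i => ?_) (hs.congr fun i => ?_)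
    · rw [ContinuousLinearMap.comp_apply, hS.apply_self, map_smul, norm_smul, mul_pow,
        Complex.norm_real, Real.norm_of_nonneg (Real.sqrt_nonneg _),
        Real.sq_sqrt (norm_nonneg _)]
    · rw [ContinuousLinearMap.adjoint_comp, hP, ContinuousLinearMap.comp_apply,
        hR.adjoint.apply_self, map_smul, norm_smul, mul_pow, RCLike.norm_conj, hnorm,
        Real.sq_sqrt (norm_nonneg _)]
  · intro e
    have hsum : Summable fun q : ι × ℕ => c q.1 * ((‖⟪e q.2, P (b q.1)⟫_ℂ‖ ^ 2 : ℝ) : ℂ) := by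
      refine Summable.of_norm ?_
      rw [summable_prod_of_nonneg fun _ => norm_nonneg _]
      have h1 : ∀ i, HasSum (fun n => ‖c i * ((‖⟪e n, P (b i)⟫_ℂ‖ ^ 2 : ℝ) : ℂ)‖)
          (‖c i‖ * ‖P (b i)‖ ^ 2) := fun i => by
        simp_rw [norm_mul, Complex.norm_real]
        refine ((e.hasSum_norm_inner_sq (P (b i))).congr_fun ?_).mul_left _
        intro n
        rw [Real.norm_of_nonneg (by positivity)]
      exact ⟨fun i => (h1 i).summable, hs.congr fun i => (h1 i).tsum_eq.symm⟩
    have hrow : ∀ i, HasSum (fun n => c i * ((‖⟪e n, P (b i)⟫_ℂ‖ ^ 2 : ℝ) : ℂ))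
        (c i * ((‖P (b i)‖ ^ 2 : ℝ) : ℂ)) := fun i =>
      (Complex.hasSum_ofReal.2 (e.hasSum_norm_inner_sq (P (b i)))).mul_left _
    have hcol : ∀ n, HasSum (fun i => c i * ((‖⟪e n, P (b i)⟫_ℂ‖ ^ 2 : ℝ) : ℂ))
        ⟪e n, (P ∘L T ∘L P) (e n)⟫_ℂ := fun n => by
      have h := b.hasSum_inner_mul_inner (P (e n)) (T (P (e n)))
      have h2 : ⟪P (e n), T (P (e n))⟫_ℂ = ⟪e n, (P ∘L T ∘L P) (e n)⟫_ℂ := by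
        conv_lhs => rw [← hP]
        rw [ContinuousLinearMap.adjoint_inner_left, hP]
        rfl
      rw [h2] at h
      refine h.congr_fun fun i => ?_
      have h3 : ⟪b i, P (e n)⟫_ℂ = ⟪P (b i), e n⟫_ℂ := by
        conv_lhs => rw [← hP]
        rw [ContinuousLinearMap.adjoint_inner_right]
      rw [hT, mul_left_comm, ← inner_conj_symm (P (e n)) (b i), Complex.conj_mul', h3,
        norm_inner_symm]
      push_cast
      rfl
    have h4 := hsum.hasSum.prod_fiberwise hrow
    rw [h4.tsum_eq]
    have h5 : HasSum (fun q : ℕ × ι => c q.2 * ((‖⟪e q.1, P (b q.2)⟫_ℂ‖ ^ 2 : ℝ) : ℂ))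
        (∑' q : ι × ℕ, c q.1 * ((‖⟪e q.2, P (b q.1)⟫_ℂ‖ ^ 2 : ℝ) : ℂ)) :=
      (Equiv.prodComm ℕ ι).hasSum_iff.2 hsum.hasSum
    exact h5.prod_fiberwise hcol

end TraceClass

/-! ### The Gaussian as a Schwartz function. -/

section Gaussian

theorem exists_one_add_pow_mul_exp_le {c : ℝ} (hc : 0 < c) (k : ℕ) :
    ∃ C, ∀ r : ℝ, 0 ≤ r → (1 + r) ^ k * Real.exp (-c * r ^ 2) ≤ C := by
  -- The factorial comes from `y ^ k / k! ≤ exp y` at `y = 1 + r`, and `1 / (4c)` is the maximum of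
  -- `r - c r²`.
  refine ⟨k.factorial * Real.exp (1 + 1 / (4 * c)), fun r hr => ?_⟩
  have h1 : (1 + r) ^ k ≤ k.factorial * Real.exp (1 + r) := by
    have := Real.pow_div_factorial_le_exp (1 + r) (by positivity) k
    rwa [div_le_iff₀ (by positivity), mul_comm] at this
  have h2 : 1 + r + -c * r ^ 2 ≤ 1 + 1 / (4 * c) := by
    have h3 : 1 / (4 * c) = c * (1 / (2 * c)) ^ 2 := by field_simp; norm_num
    have h4 : r = c * (2 * (1 / (2 * c)) * r) := by field_simp
    have h5 : c * r ^ 2 - r + 1 / (4 * c) = c * (r - 1 / (2 * c)) ^ 2 := by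
      rw [h3]; nth_rewrite 2 [h4]; ring
    have h6 : 0 ≤ c * (r - 1 / (2 * c)) ^ 2 := by positivity
    linarith
  calc (1 + r) ^ k * Real.exp (-c * r ^ 2)
      ≤ (k.factorial * Real.exp (1 + r)) * Real.exp (-c * r ^ 2) := by gcongr
    _ = k.factorial * Real.exp (1 + r + -c * r ^ 2) := by rw [Real.exp_add _ (-c * r ^ 2)]; ring
    _ ≤ _ := by gcongr

/-- The Gaussian `exp (-c |x|²)` as a Schwartz function. -/
theorem exists_schwartz_gaussian {c : ℝ} (hc : 0 < c) :
    ∃ g : 𝓢(Plane, ℂ), ∀ x, g x = ((Real.exp (-c * ‖x‖ ^ 2) : ℝ) : ℂ) := by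
  let q : Plane → ℝ := fun x => -c * ‖x‖ ^ 2
  have hq : q.HasTemperateGrowth :=
    (Function.HasTemperateGrowth.const (-c)).mul (Function.hasTemperateGrowth_norm_sq Plane)
  have hsm : ContDiff ℝ ((⊤ : ℕ∞) : WithTop ℕ∞) (Real.exp ∘ q) := Real.contDiff_exp.comp hq.1
  let g : 𝓢(Plane, ℝ) :=
    { toFun := Real.exp ∘ q
      smooth' := hsm
      decay' := fun k n => by
        obtain ⟨p, C, hC, hbd⟩ := hq.norm_iteratedFDeriv_le_uniform n
        obtain ⟨B, hB⟩ := exists_one_add_pow_mul_exp_le hc (k + p * n)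
        refine ⟨n.factorial * (1 + C) ^ n * B, fun x => ?_⟩
        have hx1 : 1 ≤ 1 + ‖x‖ := by linarith [norm_nonneg x]
        have hD1 : 1 ≤ (1 + C) * (1 + ‖x‖) ^ p :=
          one_le_mul_of_one_le_of_one_le (by linarith) (one_le_pow₀ hx1)
        -- The composition estimate needs the `i`-th derivative of `q` bounded by `D ^ i`. Since `D
        -- ≥ 1`, a common bound by `D` suffices for `i ≥ 1`.
        have h := norm_iteratedFDeriv_comp_le Real.contDiff_exp hq.1 (n := n)
          (N := ((⊤ : ℕ∞) : WithTop ℕ∞)) (by exact_mod_cast le_top) x (C := Real.exp (q x))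
          (D := (1 + C) * (1 + ‖x‖) ^ p)
          (fun i _ => by
            rw [norm_iteratedFDeriv_eq_norm_iteratedDeriv, iteratedDeriv_eq_iterate,
              Real.iter_deriv_exp, Real.norm_of_nonneg (Real.exp_pos _).le])
          (fun i hi hin => by
            refine (hbd i hin x).trans (le_trans ?_ (le_self_pow₀ hD1 (by omega)))
            gcongr
            linarith)
        calc ‖x‖ ^ k * ‖iteratedFDeriv ℝ n (Real.exp ∘ q) x‖
            ≤ (1 + ‖x‖) ^ k * (n.factorial * Real.exp (q x) * ((1 + C) * (1 + ‖x‖) ^ p) ^ n) := by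
              gcongr
              linarith
          _ = n.factorial * (1 + C) ^ n * ((1 + ‖x‖) ^ (k + p * n) * Real.exp (-c * ‖x‖ ^ 2)) := by
              rw [mul_pow, ← pow_mul, pow_add]
              ring
          _ ≤ _ := by
              gcongr
              exact hB _ (norm_nonneg x) }
  refine ⟨SchwartzMap.postcompCLM (𝕜 := ℝ) Complex.ofRealCLM g, fun x => ?_⟩
  rw [SchwartzMap.postcompCLM_apply]
  rfl

end Gaussian

/-! ### Commutation relations and adjoints on Schwartz space. -/

section Commutators

theorem partialD_comm (i j : Fin 2) (f : 𝓢(Plane, ℂ)) :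
    partialD i (partialD j f) = partialD j (partialD i f) := by
  have key : ∀ (i j : Fin 2) (x : Plane), partialD i (partialD j f) x =
      fderiv ℝ (fderiv ℝ f) x (EuclideanSpace.single i 1) (EuclideanSpace.single j 1) := by
    intro i j x
    have h : (partialD j f : Plane → ℂ) = fun y => fderiv ℝ f y (EuclideanSpace.single j 1) := by
      ext y
      exact partialD_apply j f y
    have hd : DifferentiableAt ℝ (fderiv ℝ f) x :=
      ((f.smooth 2).fderiv_right (m := 1) (by norm_num)).differentiable (by norm_num) x
    rw [partialD_apply, h, fderiv_clm_apply hd (differentiableAt_const _)]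
    simp
  ext x
  rw [key, key]
  have hs : IsSymmSndFDerivAt ℝ f x :=
    ((f.smooth 2).contDiffAt).isSymmSndFDerivAt (by simp)
  exact hs _ _

theorem coordMul_comm (i j : Fin 2) (f : 𝓢(Plane, ℂ)) :
    coordMul i (coordMul j f) = coordMul j (coordMul i f) := by
  ext x
  simp only [coordMul_apply]
  ring

theorem partialD_coordMul (i j : Fin 2) (f : 𝓢(Plane, ℂ)) :
    partialD i (coordMul j f) = coordMul j (partialD i f) + (if i = j then (1 : ℂ) else 0) • f := by
  ext x
  have h : (coordMul j f : Plane → ℂ) =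
      fun y => (Complex.ofRealCLM ∘L (EuclideanSpace.proj j : Plane →L[ℝ] ℝ)) y * f y := by
    ext y
    exact coordMul_apply j f y
  rw [partialD_apply, h, fderiv_fun_mul (ContinuousLinearMap.differentiableAt _)
    f.differentiableAt]
  simp only [ContinuousLinearMap.fderiv, add_apply, smul_apply, coordMul_apply, partialD_apply,
    ContinuousLinearMap.comp_apply, smul_eq_mul]
  rcases eq_or_ne i j with rfl | hij
  · simp [mul_comm]
  · simp [hij, hij.symm]

theorem inner_toLp_coordMul (i : Fin 2) (f g : 𝓢(Plane, ℂ)) :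
    ⟪(coordMul i f).toLp 2 volume, g.toLp 2 volume⟫_ℂ =
      ⟪f.toLp 2 volume, (coordMul i g).toLp 2 volume⟫_ℂ := by
  simp only [SchwartzMap.inner_toL2_toL2_eq, coordMul_apply, RCLike.inner_apply]
  congr 1
  ext x
  simp
  ring

theorem inner_toLp_partialD (i : Fin 2) (f g : 𝓢(Plane, ℂ)) :
    ⟪(partialD i f).toLp 2 volume, g.toLp 2 volume⟫_ℂ =
      -⟪f.toLp 2 volume, (partialD i g).toLp 2 volume⟫_ℂ := by
  have h := SchwartzMap.integral_bilinear_lineDerivOp_right_eq_neg_left (μ := volume) f g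
    ((ContinuousLinearMap.mul ℝ ℂ).comp (Complex.conjCLE : ℂ →L[ℝ] ℂ))
    (EuclideanSpace.single i (1 : ℝ))
  simp only [SchwartzMap.inner_toL2_toL2_eq, RCLike.inner_apply]
  rw [eq_neg_iff_add_eq_zero, add_comm, ← eq_neg_iff_add_eq_zero]
  simpa [mul_comm, partialD] using h

end Commutators

/-! ### Ladder operators and joint eigenfunctions. -/

section Ladder

/-- The raising operator `(x₁ + s x₂) / (2ℓ) - ℓ (∂₁ + s ∂₂)`, for `s = ± i`. -/
noncomputable def raising (ℓ : ℝ) (s : ℂ) : 𝓢(Plane, ℂ) →L[ℂ] 𝓢(Plane, ℂ) :=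
  (1 / (2 * (ℓ : ℂ))) • (coordMul 0 + s • coordMul 1) - (ℓ : ℂ) • (partialD 0 + s • partialD 1)

/-- The lowering operator `(x₁ - s x₂) / (2ℓ) + ℓ (∂₁ - s ∂₂)`, for `s = ± i`. -/
noncomputable def lowering (ℓ : ℝ) (s : ℂ) : 𝓢(Plane, ℂ) →L[ℂ] 𝓢(Plane, ℂ) :=
  (1 / (2 * (ℓ : ℂ))) • (coordMul 0 - s • coordMul 1) + (ℓ : ℂ) • (partialD 0 - s • partialD 1)

variable {ℓ : ℝ}

theorem raising_apply (s : ℂ) (f : 𝓢(Plane, ℂ)) : raising ℓ s f =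
    (1 / (2 * (ℓ : ℂ))) • (coordMul 0 f + s • coordMul 1 f) -
      (ℓ : ℂ) • (partialD 0 f + s • partialD 1 f) := rfl

theorem lowering_apply (s : ℂ) (f : 𝓢(Plane, ℂ)) : lowering ℓ s f =
    (1 / (2 * (ℓ : ℂ))) • (coordMul 0 f - s • coordMul 1 f) +
      (ℓ : ℂ) • (partialD 0 f - s • partialD 1 f) := rfl

theorem partialD_zero_coordMul_zero (f : 𝓢(Plane, ℂ)) :
    partialD 0 (coordMul 0 f) = coordMul 0 (partialD 0 f) + f := by
  simp [partialD_coordMul]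

theorem partialD_one_coordMul_one (f : 𝓢(Plane, ℂ)) :
    partialD 1 (coordMul 1 f) = coordMul 1 (partialD 1 f) + f := by
  simp [partialD_coordMul]

theorem partialD_zero_coordMul_one (f : 𝓢(Plane, ℂ)) :
    partialD 0 (coordMul 1 f) = coordMul 1 (partialD 0 f) := by
  simp [partialD_coordMul]

theorem partialD_one_coordMul_zero (f : 𝓢(Plane, ℂ)) :
    partialD 1 (coordMul 0 f) = coordMul 0 (partialD 1 f) := by
  simp [partialD_coordMul]

/-- For `s, t = ± i` the commutator `1 - s t` is `2` if `s = t` and `0` if `s = -t`, which gives two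
independent oscillators. -/
theorem lowering_raising (hℓ : ℓ ≠ 0) (s t : ℂ) (f : 𝓢(Plane, ℂ)) :
    lowering ℓ s (raising ℓ t f) = raising ℓ t (lowering ℓ s f) + (1 - s * t) • f := by
  have hℓ' : (ℓ : ℂ) ≠ 0 := by exact_mod_cast hℓ
  simp only [lowering_apply, raising_apply, map_add, map_sub, map_smul,
    partialD_zero_coordMul_zero, partialD_one_coordMul_one, partialD_zero_coordMul_one,
    partialD_one_coordMul_zero, coordMul_comm 1 0, partialD_comm 1 0]
  match_scalars <;> field_simp <;> ring

theorem raising_comm (s t : ℂ) (f : 𝓢(Plane, ℂ)) :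
    raising ℓ s (raising ℓ t f) = raising ℓ t (raising ℓ s f) := by
  simp only [raising_apply, map_add, map_sub, map_smul,
    partialD_zero_coordMul_zero, partialD_one_coordMul_one, partialD_zero_coordMul_one,
    partialD_one_coordMul_zero, coordMul_comm 1 0, partialD_comm 1 0]
  match_scalars <;> ring

/-- The derivatives cancel. With `s = ± i` this turns multiplication by `x₁ ± i x₂` into three-term
relations between eigenfunctions, used for completeness and for the density. -/
theorem raising_add_lowering (hℓ : ℓ ≠ 0) (s : ℂ) (f : 𝓢(Plane, ℂ)) :
    raising ℓ s f + lowering ℓ (-s) f = (1 / (ℓ : ℂ)) • (coordMul 0 f + s • coordMul 1 f) := by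
  have hℓ' : (ℓ : ℂ) ≠ 0 := by exact_mod_cast hℓ
  rw [raising_apply, lowering_apply]
  match_scalars <;> field_simp <;> ring

theorem landauExpr_apply_eq (hℓ : ℓ ≠ 0) (ε : ℝ) (f : 𝓢(Plane, ℂ)) :
    landauExpr ε ℓ f = ((ε : ℂ) / 2) • (raising ℓ I (lowering ℓ I f) + f) := by
  have hℓ' : (ℓ : ℂ) ≠ 0 := by exact_mod_cast hℓ
  have hI : I ^ 2 = -1 := Complex.I_sq
  simp only [landauExpr, kinetic₁, kinetic₂, lowering_apply, raising_apply, smul_apply, add_apply,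
    sub_apply, ContinuousLinearMap.comp_apply, map_add, map_sub, map_smul,
    partialD_zero_coordMul_zero, partialD_one_coordMul_one, partialD_zero_coordMul_one,
    partialD_one_coordMul_zero, coordMul_comm 1 0, partialD_comm 1 0]
  match_scalars <;> field_simp <;> ring_nf <;> simp only [hI] <;> ring

theorem oscillatorExpr_apply_eq (hℓ : ℓ ≠ 0) (f : 𝓢(Plane, ℂ)) :
    oscillatorExpr ℓ f = (1 / 2 : ℂ) • (raising ℓ I (lowering ℓ I f) +
      raising ℓ (-I) (lowering ℓ (-I) f)) + f := by
  have hℓ' : (ℓ : ℂ) ≠ 0 := by exact_mod_cast hℓ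
  have hI : I ^ 2 = -1 := Complex.I_sq
  simp only [oscillatorExpr, Fin.sum_univ_two, lowering_apply, raising_apply, smul_apply, add_apply,
    ContinuousLinearMap.comp_apply, map_add, map_sub, map_smul,
    partialD_zero_coordMul_zero, partialD_one_coordMul_one, partialD_zero_coordMul_one,
    partialD_one_coordMul_zero, coordMul_comm 1 0, partialD_comm 1 0]
  match_scalars <;> field_simp <;> ring_nf <;> simp only [hI] <;> ring

theorem inner_toLp_raising {s : ℂ} (hs : (starRingEnd ℂ) s = -s) (f g : 𝓢(Plane, ℂ)) :
    ⟪(raising ℓ s f).toLp 2 volume, g.toLp 2 volume⟫_ℂ =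
      ⟪f.toLp 2 volume, (lowering ℓ s g).toLp 2 volume⟫_ℂ := by
  have h : ∀ f : 𝓢(Plane, ℂ), f.toLp 2 volume = SchwartzMap.toLpCLM ℂ ℂ 2 volume f := fun _ => rfl
  have hX := inner_toLp_coordMul
  have hD := inner_toLp_partialD
  simp only [h] at hX hD ⊢
  simp only [raising_apply, lowering_apply, map_add, map_sub, map_smul, inner_add_left,
    inner_sub_left, inner_smul_left, inner_add_right, inner_sub_right, inner_smul_right, hX, hD, hs,
    Complex.conj_ofReal, map_div₀, map_mul, map_one, map_ofNat]
  ring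

/-- The Gaussian `exp (-|x|² / (4ℓ²))`, the common ground state. -/
noncomputable def groundState (ℓ : ℝ) : 𝓢(Plane, ℂ) :=
  if h : 0 < 1 / (4 * ℓ ^ 2) then (exists_schwartz_gaussian h).choose else 0

theorem groundState_apply (hℓ : ℓ ≠ 0) (x : Plane) :
    groundState ℓ x = ((Real.exp (-(1 / (4 * ℓ ^ 2)) * ‖x‖ ^ 2) : ℝ) : ℂ) := by
  have h : 0 < 1 / (4 * ℓ ^ 2) := by positivity
  rw [groundState, dif_pos h]
  exact (exists_schwartz_gaussian h).choose_spec x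

theorem partialD_groundState (hℓ : ℓ ≠ 0) (i : Fin 2) :
    partialD i (groundState ℓ) = (-(1 / (2 * (ℓ : ℂ) ^ 2))) • coordMul i (groundState ℓ) := by
  have hℓ' : (ℓ : ℂ) ≠ 0 := by exact_mod_cast hℓ
  ext x
  have hf : (groundState ℓ : Plane → ℂ) =
      fun x => ((Real.exp (-(1 / (4 * ℓ ^ 2)) * ‖x‖ ^ 2) : ℝ) : ℂ) :=
    funext (groundState_apply hℓ)
  have h1 : HasFDerivAt (fun x : Plane => ‖x‖ ^ 2) (2 • (innerSL ℝ x)) x :=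
    (hasStrictFDerivAt_norm_sq x).hasFDerivAt
  have h2 := ((h1.const_mul (-(1 / (4 * ℓ ^ 2)))).exp)
  have h4 : HasFDerivAt (groundState ℓ : Plane → ℂ) (Complex.ofRealCLM ∘L
      (Real.exp (-(1 / (4 * ℓ ^ 2)) * ‖x‖ ^ 2) •
        ((-(1 / (4 * ℓ ^ 2))) • (2 • (innerSL ℝ x))))) x := by
    rw [hf]
    exact (Complex.ofRealCLM.hasFDerivAt (x := Real.exp (-(1 / (4 * ℓ ^ 2)) * ‖x‖ ^ 2))).comp x h2
  rw [partialD_apply, h4.fderiv, smul_apply, coordMul_apply, groundState_apply hℓ]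
  simp only [ContinuousLinearMap.comp_apply, smul_apply, innerSL_apply_apply]
  simp [EuclideanSpace.inner_single_right]
  field_simp
  ring

theorem lowering_groundState (hℓ : ℓ ≠ 0) (s : ℂ) : lowering ℓ s (groundState ℓ) = 0 := by
  have hℓ' : (ℓ : ℂ) ≠ 0 := by exact_mod_cast hℓ
  rw [lowering_apply, partialD_groundState hℓ, partialD_groundState hℓ]
  match_scalars <;> field_simp <;> ring

/-- The unnormalized joint eigenfunctions of the Landau Hamiltonian and the oscillator. -/
noncomputable def landauFun (ℓ : ℝ) (n m : ℕ) : 𝓢(Plane, ℂ) :=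
  (raising ℓ I)^[n] ((raising ℓ (-I))^[m] (groundState ℓ))

theorem raising_landauFun (n m : ℕ) : raising ℓ I (landauFun ℓ n m) = landauFun ℓ (n + 1) m := by
  rw [landauFun, landauFun, Function.iterate_succ_apply']

theorem raising_neg_landauFun (n m : ℕ) :
    raising ℓ (-I) (landauFun ℓ n m) = landauFun ℓ n (m + 1) := by
  induction n with
  | zero =>
    rw [landauFun, landauFun, Function.iterate_succ_apply']
    rfl
  | succ n ih => rw [← raising_landauFun, raising_comm, ih, raising_landauFun]

/-- Each exchange with a raising operator of the same type contributes `2`, and the ground state is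
annihilated. For `n = 0` the truncated index `n - 1` is harmless because the coefficient vanishes.
-/
theorem lowering_landauFun (hℓ : ℓ ≠ 0) (n m : ℕ) :
    lowering ℓ I (landauFun ℓ n m) = (2 * n : ℂ) • landauFun ℓ (n - 1) m := by
  induction n with
  | zero =>
    simp only [Nat.cast_zero, mul_zero, zero_smul]
    induction m with
    | zero => exact lowering_groundState hℓ I
    | succ m ih =>
      rw [← raising_neg_landauFun, lowering_raising hℓ, ih]
      simp
  | succ n ih =>
    rw [← raising_landauFun, lowering_raising hℓ, ih, map_smul, raising_landauFun,
      Nat.add_sub_cancel]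
    rcases n with _ | n
    · simp; norm_num
    · rw [Nat.add_sub_cancel, ← add_smul]
      congr 1
      push_cast
      linear_combination -Complex.I_mul_I

theorem lowering_neg_landauFun (hℓ : ℓ ≠ 0) (n m : ℕ) :
    lowering ℓ (-I) (landauFun ℓ n m) = (2 * m : ℂ) • landauFun ℓ n (m - 1) := by
  induction m with
  | zero =>
    simp only [Nat.cast_zero, mul_zero, zero_smul]
    induction n with
    | zero => exact lowering_groundState hℓ (-I)
    | succ n ih =>
      rw [← raising_landauFun, lowering_raising hℓ, ih]
      simp
  | succ m ih =>
    rw [← raising_neg_landauFun, lowering_raising hℓ, ih, map_smul, raising_neg_landauFun,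
      Nat.add_sub_cancel]
    rcases m with _ | m
    · simp; norm_num
    · rw [Nat.add_sub_cancel, ← add_smul]
      congr 1
      push_cast
      linear_combination -Complex.I_mul_I

theorem number_landauFun (hℓ : ℓ ≠ 0) (n m : ℕ) :
    raising ℓ I (lowering ℓ I (landauFun ℓ n m)) = (2 * n : ℂ) • landauFun ℓ n m := by
  rw [lowering_landauFun hℓ, map_smul, raising_landauFun]
  rcases n with _ | n
  · simp
  · rfl

theorem number_neg_landauFun (hℓ : ℓ ≠ 0) (n m : ℕ) :
    raising ℓ (-I) (lowering ℓ (-I) (landauFun ℓ n m)) = (2 * m : ℂ) • landauFun ℓ n m := by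
  rw [lowering_neg_landauFun hℓ, map_smul, raising_neg_landauFun]
  rcases m with _ | m
  · simp
  · rfl

theorem landauExpr_landauFun (hℓ : ℓ ≠ 0) (ε : ℝ) (n m : ℕ) :
    landauExpr ε ℓ (landauFun ℓ n m) = (((ε * (n + 1 / 2) : ℝ)) : ℂ) • landauFun ℓ n m := by
  rw [landauExpr_apply_eq hℓ, number_landauFun hℓ]
  push_cast
  module

theorem oscillatorExpr_landauFun (hℓ : ℓ ≠ 0) (n m : ℕ) :
    oscillatorExpr ℓ (landauFun ℓ n m) = (((n + m + 1 : ℝ)) : ℂ) • landauFun ℓ n m := by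
  rw [oscillatorExpr_apply_eq hℓ, number_landauFun hℓ, number_neg_landauFun hℓ]
  push_cast
  module

end Ladder

/-! ### Completeness of the joint eigenfunctions. -/

section Completeness

open scoped FourierTransform in
-- A test function is the Fourier transform of a Schwartz function, and the transform can be moved
-- across the integral onto `F`.
theorem ae_eq_zero_of_fourier_eq_zero {F : Plane → ℂ} (hF : Integrable F)
    (h : ∀ w, 𝓕 F w = 0) : ∀ᵐ x, F x = 0 := by
  refine ae_eq_zero_of_integral_contDiff_smul_eq_zero hF.locallyIntegrable fun ψ hψ hψc => ?_
  have hc : HasCompactSupport fun x => (ψ x : ℂ) := hψc.comp_left Complex.ofReal_zero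
  let φ : 𝓢(Plane, ℂ) := hc.toSchwartzMap (Complex.ofRealCLM.contDiff.comp hψ)
  have hφ : ∀ x, (ψ x : ℂ) = 𝓕 (𝓕⁻ φ : 𝓢(Plane, ℂ)) x := fun x => by
    rw [FourierTransform.fourier_fourierInv_eq]
    rfl
  have hflip := VectorFourier.integral_fourierIntegral_smul_eq_flip (L := innerₗ Plane)
    (μ := volume) (ν := volume) (f := F) (g := (𝓕⁻ φ : 𝓢(Plane, ℂ))) Real.continuous_fourierChar
    continuous_inner hF (SchwartzMap.integrable _)
  have hzero : ∀ w, VectorFourier.fourierIntegral Real.fourierChar volume (innerₗ Plane) F w = 0 := h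
  simp only [hzero, zero_smul, integral_zero] at hflip
  rw [flip_innerₗ] at hflip
  rw [hflip]
  refine integral_congr_ae (ae_of_all _ fun x => ?_)
  change ψ x • F x = F x • (𝓕 (𝓕⁻ φ : 𝓢(Plane, ℂ)) x)
  rw [← hφ, smul_eq_mul, mul_comm, Complex.real_smul]

variable {ℓ : ℝ}

theorem inner_toLp_left (h : 𝓢(Plane, ℂ)) (f : L2Plane) :
    ⟪h.toLp 2 volume, f⟫_ℂ = ∫ x, f x * (starRingEnd ℂ) (h x) := by
  rw [L2.inner_def]
  refine integral_congr_ae ?_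
  filter_upwards [h.coeFn_toLp 2 volume] with x hx
  rw [hx, RCLike.inner_apply]

/-- The span of the joint eigenfunctions, inside the Schwartz space. -/
noncomputable def landauSpan (ℓ : ℝ) : Submodule ℂ 𝓢(Plane, ℂ) :=
  Submodule.span ℂ (Set.range fun q : ℕ × ℕ => landauFun ℓ q.1 q.2)

theorem landauFun_mem (n m : ℕ) : landauFun ℓ n m ∈ landauSpan ℓ :=
  Submodule.subset_span ⟨(n, m), rfl⟩

theorem coordMul_mem_landauSpan (hℓ : ℓ ≠ 0) (i : Fin 2) {h : 𝓢(Plane, ℂ)}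
    (hh : h ∈ landauSpan ℓ) : coordMul i h ∈ landauSpan ℓ := by
  have hℓ' : (ℓ : ℂ) ≠ 0 := by exact_mod_cast hℓ
  suffices hle : landauSpan ℓ ≤ (landauSpan ℓ).comap (coordMul i).toLinearMap from hle hh
  refine Submodule.span_le.2 ?_
  rintro _ ⟨⟨n, m⟩, rfl⟩
  have h1 : coordMul 0 (landauFun ℓ n m) + I • coordMul 1 (landauFun ℓ n m) ∈ landauSpan ℓ := by
    have h := raising_add_lowering hℓ I (landauFun ℓ n m)
    rw [raising_landauFun, lowering_neg_landauFun hℓ] at h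
    have h' : (ℓ : ℂ) • (landauFun ℓ (n + 1) m + (2 * m : ℂ) • landauFun ℓ n (m - 1)) ∈
        landauSpan ℓ :=
      Submodule.smul_mem _ _ (Submodule.add_mem _ (landauFun_mem _ _)
        (Submodule.smul_mem _ _ (landauFun_mem _ _)))
    rwa [h, smul_smul, mul_one_div_cancel hℓ', one_smul] at h'
  have h2 : coordMul 0 (landauFun ℓ n m) + (-I) • coordMul 1 (landauFun ℓ n m) ∈ landauSpan ℓ := by
    have h := raising_add_lowering hℓ (-I) (landauFun ℓ n m)
    rw [raising_neg_landauFun, neg_neg, lowering_landauFun hℓ] at h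
    have h' : (ℓ : ℂ) • (landauFun ℓ n (m + 1) + (2 * n : ℂ) • landauFun ℓ (n - 1) m) ∈
        landauSpan ℓ :=
      Submodule.smul_mem _ _ (Submodule.add_mem _ (landauFun_mem _ _)
        (Submodule.smul_mem _ _ (landauFun_mem _ _)))
    rwa [h, smul_smul, mul_one_div_cancel hℓ', one_smul] at h'
  change coordMul i (landauFun ℓ n m) ∈ landauSpan ℓ
  fin_cases i
  · have h3 := Submodule.smul_mem _ (1 / 2 : ℂ) (Submodule.add_mem _ h1 h2)
    convert h3 using 1
    simp only [Fin.zero_eta]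
    module
  · have h3 := Submodule.smul_mem _ (-I / 2 : ℂ) (Submodule.sub_mem _ h1 h2)
    convert h3 using 1
    simp only [Fin.mk_one]
    match_scalars
    · ring_nf
      simp
    · ring

theorem exists_mem_landauSpan (hℓ : ℓ ≠ 0) (w : Plane) (k : ℕ) :
    ∃ h ∈ landauSpan ℓ, ∀ x, h x = ((⟪x, w⟫_ℝ ^ k : ℝ) : ℂ) * groundState ℓ x := by
  induction k with
  | zero => exact ⟨_, landauFun_mem 0 0, fun x => by simp [landauFun]⟩
  | succ k ih =>
    obtain ⟨h, hh, hx⟩ := ih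
    refine ⟨(w 0 : ℂ) • coordMul 0 h + (w 1 : ℂ) • coordMul 1 h,
      Submodule.add_mem _ (Submodule.smul_mem _ _ (coordMul_mem_landauSpan hℓ 0 hh))
        (Submodule.smul_mem _ _ (coordMul_mem_landauSpan hℓ 1 hh)), fun x => ?_⟩
    have hinner : ⟪x, w⟫_ℝ = w 0 * x 0 + w 1 * x 1 := by
      simp [PiLp.inner_apply, Fin.sum_univ_two]
    simp only [add_apply, smul_apply, smul_eq_mul, coordMul_apply, hx]
    rw [pow_succ]
    push_cast
    nth_rewrite 4 [hinner]
    push_cast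
    ring

theorem integrable_exp_mul_groundState_mul (hℓ : ℓ ≠ 0) (κ : ℝ) (f : L2Plane) :
    Integrable fun x => Real.exp (κ * ‖x‖) * ‖f x * groundState ℓ x‖ := by
  -- Half of the Gaussian exponent absorbs `exp (κ ‖x‖)` by completing the square. The other half is
  -- a square integrable Gaussian that pairs with `f`.
  have hc : 0 < 1 / (8 * ℓ ^ 2) := by positivity
  obtain ⟨G, hG⟩ := exists_schwartz_gaussian hc
  have hint : Integrable fun x => G x * f x :=
    (G.memLp 2 volume).integrable_mul (Lp.memLp f)
  refine (hint.norm.const_mul (Real.exp (2 * ℓ ^ 2 * κ ^ 2))).mono' ?_ (ae_of_all _ fun x => ?_)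
  · exact (by fun_prop : Continuous fun x : Plane => Real.exp (κ * ‖x‖)).aestronglyMeasurable.mul
      ((Lp.aestronglyMeasurable f).mul (groundState ℓ).continuous.aestronglyMeasurable).norm
  · rw [norm_mul, norm_norm, norm_mul, norm_mul, groundState_apply hℓ, hG, Complex.norm_real,
      Complex.norm_real, Real.norm_of_nonneg (Real.exp_pos _).le,
      Real.norm_of_nonneg (Real.exp_pos _).le, Real.norm_of_nonneg (Real.exp_pos _).le]
    have hexp : Real.exp (κ * ‖x‖) * Real.exp (-(1 / (4 * ℓ ^ 2)) * ‖x‖ ^ 2) ≤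
        Real.exp (2 * ℓ ^ 2 * κ ^ 2) * Real.exp (-(1 / (8 * ℓ ^ 2)) * ‖x‖ ^ 2) := by
      rw [← Real.exp_add, ← Real.exp_add]
      refine Real.exp_le_exp.2 ?_
      have h1 : 2 * ℓ ^ 2 * κ ^ 2 + -(1 / (8 * ℓ ^ 2)) * ‖x‖ ^ 2 -
          (κ * ‖x‖ + -(1 / (4 * ℓ ^ 2)) * ‖x‖ ^ 2) =
          1 / (8 * ℓ ^ 2) * (‖x‖ - 4 * ℓ ^ 2 * κ) ^ 2 := by
        field_simp
        ring
      have h2 : 0 ≤ 1 / (8 * ℓ ^ 2) * (‖x‖ - 4 * ℓ ^ 2 * κ) ^ 2 := by positivity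
      linarith
    calc _ = (Real.exp (κ * ‖x‖) * Real.exp (-(1 / (4 * ℓ ^ 2)) * ‖x‖ ^ 2)) * ‖f x‖ := by ring
      _ ≤ _ := by
        rw [← mul_assoc]
        gcongr

open scoped FourierTransform in
-- The span contains every `⟪x, w⟫ ^ k` times the Gaussian, so all these moments of `f *
-- groundState` vanish. Exponential integrability permits termwise integration of the series of `exp
-- (-2πi ⟪x, w⟫)`, hence the Fourier transform vanishes.
theorem eq_zero_of_forall_inner_landauFun (hℓ : ℓ ≠ 0) (f : L2Plane)
    (h : ∀ n m, ⟪(landauFun ℓ n m).toLp 2 volume, f⟫_ℂ = 0) : f = 0 := by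
  have hspan : ∀ u ∈ landauSpan ℓ, ⟪u.toLp 2 volume, f⟫_ℂ = 0 := by
    intro u hu
    induction hu using Submodule.span_induction with
    | mem u hu =>
      obtain ⟨q, rfl⟩ := hu
      exact h q.1 q.2
    | zero =>
      rw [show (0 : 𝓢(Plane, ℂ)).toLp 2 volume = 0 from
        (SchwartzMap.toLpCLM ℂ ℂ 2 (volume : Measure Plane)).map_zero, inner_zero_left]
    | add u v _ _ hu hv =>
      rw [show (u + v).toLp 2 volume = u.toLp 2 volume + v.toLp 2 volume from
        (SchwartzMap.toLpCLM ℂ ℂ 2 (volume : Measure Plane)).map_add u v, inner_add_left, hu, hv,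
        add_zero]
    | smul a u _ hu =>
      rw [show (a • u).toLp 2 volume = a • u.toLp 2 volume from
        (SchwartzMap.toLpCLM ℂ ℂ 2 (volume : Measure Plane)).map_smul a u, inner_smul_left, hu,
        mul_zero]
  have hconj : ∀ x, (starRingEnd ℂ) (groundState ℓ x) = groundState ℓ x := fun x => by
    rw [groundState_apply hℓ, Complex.conj_ofReal]
  have hmom : ∀ (w : Plane) (k : ℕ),
      ∫ x, ((⟪x, w⟫_ℝ ^ k : ℝ) : ℂ) * (f x * groundState ℓ x) = 0 := fun w k => by
    obtain ⟨u, hu, hux⟩ := exists_mem_landauSpan hℓ w k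
    rw [← hspan u hu, inner_toLp_left]
    congr 1
    ext x
    rw [hux, map_mul, hconj, Complex.conj_ofReal]
    ring
  have hint := fun κ => integrable_exp_mul_groundState_mul hℓ κ f
  have hmeas : AEStronglyMeasurable (fun x => f x * groundState ℓ x) volume :=
    (Lp.aestronglyMeasurable f).mul (groundState ℓ).continuous.aestronglyMeasurable
  have hF : Integrable fun x => f x * groundState ℓ x := by
    have := hint 0
    simp only [zero_mul, Real.exp_zero, one_mul] at this
    exact (integrable_norm_iff hmeas).1 this
  have hzero : ∀ᵐ x, f x * groundState ℓ x = 0 := by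
    refine ae_eq_zero_of_fourier_eq_zero hF fun w => ?_
    rw [Real.fourier_eq']
    set κ := 2 * Real.pi * ‖w‖ with hκ
    have hexpR : ∀ x : Plane, HasSum (fun k : ℕ => (κ * ‖x‖) ^ k / k.factorial *
        ‖f x * groundState ℓ x‖) (Real.exp (κ * ‖x‖) * ‖f x * groundState ℓ x‖) := fun x => by
      have := NormedSpace.expSeries_div_hasSum_exp (κ * ‖x‖)
      rw [← Real.exp_eq_exp_ℝ] at this
      exact this.mul_right _
    have hsum := hasSum_integral_of_dominated_convergence
      (μ := volume) (F := fun (k : ℕ) (x : Plane) => (((-2 * Real.pi * ⟪x, w⟫_ℝ : ℝ) : ℂ) * I) ^ k /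
        k.factorial * (f x * groundState ℓ x))
      (f := fun x => Complex.exp (((-2 * Real.pi * ⟪x, w⟫_ℝ : ℝ) : ℂ) * I) •
        (f x * groundState ℓ x))
      (fun k x => (κ * ‖x‖) ^ k / k.factorial * ‖f x * groundState ℓ x‖)
      (fun k => (by fun_prop : Continuous fun x : Plane =>
        (((-2 * Real.pi * ⟪x, w⟫_ℝ : ℝ) : ℂ) * I) ^ k /
        (k.factorial : ℂ)).aestronglyMeasurable.mul hmeas)
      (fun k => ae_of_all _ fun x => ?_) (ae_of_all _ fun x => (hexpR x).summable) ?_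
      (ae_of_all _ fun x => ?_)
    · refine hsum.unique ?_
      have hk : ∀ k : ℕ, ∫ x, (((-2 * Real.pi * ⟪x, w⟫_ℝ : ℝ) : ℂ) * I) ^ k /
          k.factorial * (f x * groundState ℓ x) = 0 := fun k => by
        have : ∀ x, (((-2 * Real.pi * ⟪x, w⟫_ℝ : ℝ) : ℂ) * I) ^ k /
          k.factorial * (f x * groundState ℓ x) = (((-2 * Real.pi : ℝ) : ℂ) * I) ^ k / k.factorial *
            (((⟪x, w⟫_ℝ ^ k : ℝ) : ℂ) * (f x * groundState ℓ x)) := fun x => by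
          push_cast
          rw [mul_right_comm _ _ I, mul_pow _ (⟪x, w⟫_ℝ : ℂ)]
          ring
        simp_rw [this]
        rw [integral_const_mul, hmom, mul_zero]
      simp_rw [hk]
      exact hasSum_zero
    · rw [norm_mul, norm_div, norm_pow, norm_mul, Complex.norm_I, mul_one, Complex.norm_real,
        RCLike.norm_natCast]
      gcongr
      rw [norm_mul, norm_mul, norm_neg, hκ]
      have h1 := abs_real_inner_le_norm x w
      simp only [Real.norm_eq_abs, abs_of_pos Real.pi_pos, abs_two]
      nlinarith [Real.pi_pos]
    · simp_rw [fun x => (hexpR x).tsum_eq]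
      exact hint κ
    · have := NormedSpace.expSeries_div_hasSum_exp
        ((((-2 * Real.pi * ⟪x, w⟫_ℝ : ℝ) : ℂ) * I))
      rw [← Complex.exp_eq_exp_ℂ] at this
      exact this.mul_right _
  rw [Lp.eq_zero_iff_ae_eq_zero]
  filter_upwards [hzero] with x hx
  refine (mul_eq_zero.1 hx).resolve_right ?_
  rw [groundState_apply hℓ]
  exact_mod_cast (Real.exp_pos _).ne'

end Completeness

/-! ### Orthonormality and the joint eigenbasis. -/

section Basis

variable {ℓ : ℝ}

theorem inner_toLp_raising_right {s : ℂ} (hs : (starRingEnd ℂ) s = -s) (f g : 𝓢(Plane, ℂ)) :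
    ⟪f.toLp 2 volume, (raising ℓ s g).toLp 2 volume⟫_ℂ =
      ⟪(lowering ℓ s f).toLp 2 volume, g.toLp 2 volume⟫_ℂ := by
  rw [← inner_conj_symm, inner_toLp_raising hs, inner_conj_symm]

theorem inner_toLp_number {s : ℂ} (hs : (starRingEnd ℂ) s = -s) (f g : 𝓢(Plane, ℂ)) :
    ⟪(raising ℓ s (lowering ℓ s f)).toLp 2 volume, g.toLp 2 volume⟫_ℂ =
      ⟪f.toLp 2 volume, (raising ℓ s (lowering ℓ s g)).toLp 2 volume⟫_ℂ := by
  rw [inner_toLp_raising hs, inner_toLp_raising_right hs]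

theorem conj_I_eq_neg : (starRingEnd ℂ) I = -I := Complex.conj_I

theorem conj_neg_I_eq_neg : (starRingEnd ℂ) (-I) = -(-I) := by
  rw [map_neg, Complex.conj_I]

theorem toLp_add (f g : 𝓢(Plane, ℂ)) :
    (f + g).toLp 2 volume = f.toLp 2 volume + g.toLp 2 (volume : Measure Plane) :=
  (SchwartzMap.toLpCLM ℂ ℂ 2 (volume : Measure Plane)).map_add f g

theorem toLp_smul (c : ℂ) (f : 𝓢(Plane, ℂ)) :
    (c • f).toLp 2 volume = c • f.toLp 2 (volume : Measure Plane) :=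
  (SchwartzMap.toLpCLM ℂ ℂ 2 (volume : Measure Plane)).map_smul c f

/-- The two symmetric number operators have eigenvalues `2n` and `2m`, which together separate the
indices. -/
theorem inner_landauFun_eq_zero (hℓ : ℓ ≠ 0) {p q : ℕ × ℕ} (hpq : p ≠ q) :
    ⟪(landauFun ℓ p.1 p.2).toLp 2 volume, (landauFun ℓ q.1 q.2).toLp 2 volume⟫_ℂ = 0 := by
  have h1 := inner_toLp_number (ℓ := ℓ) conj_I_eq_neg (landauFun ℓ p.1 p.2) (landauFun ℓ q.1 q.2)
  have h2 := inner_toLp_number (ℓ := ℓ) conj_neg_I_eq_neg (landauFun ℓ p.1 p.2)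
    (landauFun ℓ q.1 q.2)
  simp only [number_landauFun hℓ, number_neg_landauFun hℓ, toLp_smul, inner_smul_left,
    inner_smul_right, map_mul, map_ofNat, Complex.conj_natCast] at h1 h2
  by_contra h0
  have e1 : (p.1 : ℂ) = q.1 := by
    have := mul_right_cancel₀ h0 h1
    exact mul_left_cancel₀ two_ne_zero this
  have e2 : (p.2 : ℂ) = q.2 := by
    have := mul_right_cancel₀ h0 h2
    exact mul_left_cancel₀ two_ne_zero this
  exact hpq (Prod.ext (by exact_mod_cast e1) (by exact_mod_cast e2))

/-- The squared norm of `landauFun ℓ n m`. -/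
noncomputable def landauNormSq (ℓ : ℝ) (n m : ℕ) : ℝ :=
  2 ^ n * n.factorial * (2 ^ m * m.factorial) * (2 * Real.pi * ℓ ^ 2)

theorem landauNormSq_pos (hℓ : ℓ ≠ 0) (n m : ℕ) : 0 < landauNormSq ℓ n m := by
  have := Real.pi_pos
  unfold landauNormSq
  positivity

theorem inner_groundState (hℓ : ℓ ≠ 0) :
    ⟪(groundState ℓ).toLp 2 volume, (groundState ℓ).toLp 2 volume⟫_ℂ =
      ((2 * Real.pi * ℓ ^ 2 : ℝ) : ℂ) := by
  have hc : 0 < 1 / (2 * ℓ ^ 2) := by positivity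
  simp only [SchwartzMap.inner_toL2_toL2_eq]
  have h := GaussianFourier.integral_rexp_neg_mul_sq_norm (V := Plane) hc
  have h2 : ∀ x : Plane, ⟪groundState ℓ x, groundState ℓ x⟫_ℂ =
      ((Real.exp (-(1 / (2 * ℓ ^ 2)) * ‖x‖ ^ 2) : ℝ) : ℂ) := fun x => by
    rw [RCLike.inner_apply, groundState_apply hℓ, Complex.conj_ofReal, ← Complex.ofReal_mul,
      ← Real.exp_add]
    congr 2
    field_simp
    ring
  simp_rw [h2]
  rw [integral_complex_ofReal, h]
  congr 1
  simp
  field_simp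

theorem inner_landauFun_self (hℓ : ℓ ≠ 0) (n m : ℕ) :
    ⟪(landauFun ℓ n m).toLp 2 volume, (landauFun ℓ n m).toLp 2 volume⟫_ℂ =
      (landauNormSq ℓ n m : ℂ) := by
  induction n with
  | zero =>
    induction m with
    | zero =>
      have := inner_groundState hℓ
      simpa [landauFun, landauNormSq] using this
    | succ m ih =>
      rw [← raising_neg_landauFun, inner_toLp_raising conj_neg_I_eq_neg, raising_neg_landauFun,
        lowering_neg_landauFun hℓ, Nat.add_sub_cancel, toLp_smul, inner_smul_right, ih,
        landauNormSq, landauNormSq, Nat.factorial_succ]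
      push_cast
      ring
  | succ n ih =>
    rw [← raising_landauFun, inner_toLp_raising conj_I_eq_neg, raising_landauFun,
      lowering_landauFun hℓ, Nat.add_sub_cancel, toLp_smul, inner_smul_right, ih,
      landauNormSq, landauNormSq, Nat.factorial_succ]
    push_cast
    ring

/-- The normalized joint eigenfunctions. -/
noncomputable def landauState (ℓ : ℝ) (q : ℕ × ℕ) : 𝓢(Plane, ℂ) :=
  (((√(landauNormSq ℓ q.1 q.2))⁻¹ : ℝ) : ℂ) • landauFun ℓ q.1 q.2

theorem exists_landauBasis (hℓ : ℓ ≠ 0) :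
    ∃ b : HilbertBasis (ℕ × ℕ) ℂ L2Plane, ∀ q, b q = (landauState ℓ q).toLp 2 volume := by
  have hon : Orthonormal ℂ fun q : ℕ × ℕ => (landauState ℓ q).toLp 2 (volume : Measure Plane) := by
    rw [orthonormal_iff_ite]
    intro p q
    simp only [landauState, toLp_smul, inner_smul_left, inner_smul_right, Complex.conj_ofReal]
    split_ifs with h
    · subst h
      rw [inner_landauFun_self hℓ, ← Complex.ofReal_mul, ← Complex.ofReal_mul]
      have hpos := landauNormSq_pos hℓ p.1 p.2
      have h1 := Real.sqrt_pos.2 hpos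
      have h2 := Real.mul_self_sqrt hpos.le
      rw [← Complex.ofReal_one]
      congr 1
      nth_rewrite 3 [← h2]
      field_simp
    · rw [inner_landauFun_eq_zero hℓ h]
      simp
  refine ⟨HilbertBasis.mkOfOrthogonalEqBot hon ?_, fun q => by
    rw [HilbertBasis.coe_mkOfOrthogonalEqBot]⟩
  rw [Submodule.eq_bot_iff]
  intro f hf
  refine eq_zero_of_forall_inner_landauFun hℓ f fun n m => ?_
  have h := hf _ (Submodule.subset_span ⟨(n, m), rfl⟩)
  simp only [landauState, toLp_smul, inner_smul_left, Complex.conj_ofReal] at h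
  refine (mul_eq_zero.1 h).resolve_left ?_
  have h1 := Real.sqrt_pos.2 (landauNormSq_pos hℓ n m)
  exact_mod_cast (inv_pos.2 h1).ne'

end Basis

/-! ### The closed operators in the joint eigenbasis. -/

section ClosureGraph

/-- The coefficient relation holds on Schwartz functions by symmetry and is a closed condition.
Conversely, partial sums of the basis expansion are Schwartz and converge in the graph. This makes
the closure the maximal diagonal operator. -/
theorem mem_closureGraph_iff {ι : Type*} (A : 𝓢(Plane, ℂ) →L[ℂ] 𝓢(Plane, ℂ))
    (b : HilbertBasis ι ℂ L2Plane) (ψ : ι → 𝓢(Plane, ℂ)) (e : ι → ℝ)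
    (hb : ∀ i, b i = (ψ i).toLp 2 volume) (hA : ∀ i, A (ψ i) = (e i : ℂ) • ψ i)
    (hsymm : ∀ f g : 𝓢(Plane, ℂ), ⟪(A f).toLp 2 volume, g.toLp 2 volume⟫_ℂ =
      ⟪f.toLp 2 volume, (A g).toLp 2 volume⟫_ℂ) (f h : L2Plane) :
    (f, h) ∈ closureGraph A ↔ ∀ i, ⟪b i, h⟫_ℂ = e i * ⟪b i, f⟫_ℂ := by
  constructor
  · intro hfh i
    have hclosed : IsClosed {p : L2Plane × L2Plane | ⟪b i, p.2⟫_ℂ = e i * ⟪b i, p.1⟫_ℂ} :=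
      isClosed_eq (by fun_prop) (by fun_prop)
    refine (closure_minimal ?_ hclosed) hfh
    rintro _ ⟨u, rfl⟩
    change ⟪b i, (A u).toLp 2 volume⟫_ℂ = e i * ⟪b i, u.toLp 2 volume⟫_ℂ
    rw [hb, ← hsymm, hA, toLp_smul, inner_smul_left, Complex.conj_ofReal]
  · intro hfh
    have h1 := (b.hasSum_repr f).prodMk (b.hasSum_repr h)
    refine mem_closure_of_tendsto h1 (Eventually.of_forall fun F => ?_)
    rw [SetLike.mem_coe]
    refine Submodule.sum_mem _ fun i _ => ?_
    refine ⟨b.repr f i • ψ i, ?_⟩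
    change ((b.repr f i • ψ i).toLp 2 volume, (A (b.repr f i • ψ i)).toLp 2 volume) = _
    rw [map_smul, hA, toLp_smul, toLp_smul, toLp_smul, ← hb]
    simp only [b.repr_apply_apply, hfh, smul_smul]
    rw [mul_comm]

variable {ℓ : ℝ}

theorem landauExpr_symm (hℓ : ℓ ≠ 0) (ε : ℝ) (f g : 𝓢(Plane, ℂ)) :
    ⟪(landauExpr ε ℓ f).toLp 2 volume, g.toLp 2 volume⟫_ℂ =
      ⟪f.toLp 2 volume, (landauExpr ε ℓ g).toLp 2 volume⟫_ℂ := by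
  simp only [landauExpr_apply_eq hℓ, toLp_smul, toLp_add, inner_smul_left, inner_smul_right,
    inner_add_left, inner_add_right, inner_toLp_number conj_I_eq_neg, map_div₀, Complex.conj_ofReal,
    map_ofNat]

theorem oscillatorExpr_symm (hℓ : ℓ ≠ 0) (f g : 𝓢(Plane, ℂ)) :
    ⟪(oscillatorExpr ℓ f).toLp 2 volume, g.toLp 2 volume⟫_ℂ =
      ⟪f.toLp 2 volume, (oscillatorExpr ℓ g).toLp 2 volume⟫_ℂ := by
  simp only [oscillatorExpr_apply_eq hℓ, toLp_smul, toLp_add, inner_smul_left, inner_smul_right,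
    inner_add_left, inner_add_right, inner_toLp_number conj_I_eq_neg,
    inner_toLp_number conj_neg_I_eq_neg, map_div₀, map_one, map_ofNat]

variable {b : HilbertBasis (ℕ × ℕ) ℂ L2Plane}

theorem mem_closureGraph_landauExpr (hℓ : ℓ ≠ 0) (ε : ℝ)
    (hb : ∀ q, b q = (landauState ℓ q).toLp 2 volume) (f h : L2Plane) :
    (f, h) ∈ closureGraph (landauExpr ε ℓ) ↔
      ∀ q, ⟪b q, h⟫_ℂ = ((ε * (q.1 + 1 / 2) : ℝ) : ℂ) * ⟪b q, f⟫_ℂ :=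
  mem_closureGraph_iff _ b (landauState ℓ) _ hb
    (fun q => by rw [landauState, map_smul, landauExpr_landauFun hℓ, smul_comm])
    (landauExpr_symm hℓ ε) f h

theorem mem_closureGraph_oscillatorExpr (hℓ : ℓ ≠ 0)
    (hb : ∀ q, b q = (landauState ℓ q).toLp 2 volume) (f h : L2Plane) :
    (f, h) ∈ closureGraph (oscillatorExpr ℓ) ↔
      ∀ q, ⟪b q, h⟫_ℂ = ((q.1 + q.2 + 1 : ℝ) : ℂ) * ⟪b q, f⟫_ℂ :=
  mem_closureGraph_iff _ b (landauState ℓ) _ hb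
    (fun q => by rw [landauState, map_smul, oscillatorExpr_landauFun hℓ, smul_comm])
    (oscillatorExpr_symm hℓ) f h

theorem landauProjection_basis (hℓ : ℓ ≠ 0) (ε : ℝ)
    (hb : ∀ q, b q = (landauState ℓ q).toLp 2 volume) (k m : ℕ) :
    landauProjection ε ℓ k (b (k, m)) = b (k, m) := by
  rw [landauProjection, Submodule.starProjection_eq_self_iff, mem_closureEigenspace,
    mem_closureGraph_landauExpr hℓ ε hb]
  intro q
  rw [inner_smul_right, orthonormal_iff_ite.1 b.orthonormal]
  split_ifs with h
  · rw [h]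
    push_cast
    ring
  · simp

theorem IsDiagonal.of_apply_self {H : Type*} [NormedAddCommGroup H] [InnerProductSpace ℂ H]
    [CompleteSpace H] {ι : Type*} {b : HilbertBasis ι ℂ H} {T : H →L[ℂ] H} {c : ι → ℂ}
    (h : ∀ i, T (b i) = c i • b i) : IsDiagonal b T c := by
  classical
  have h2 : ∀ i, ContinuousLinearMap.adjoint T (b i) = (starRingEnd ℂ) (c i) • b i := fun i => by
    refine b.ext_inner fun j => ?_
    rw [ContinuousLinearMap.adjoint_inner_right, h, inner_smul_left, inner_smul_right,
      orthonormal_iff_ite.1 b.orthonormal]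
    split_ifs with hij
    · rw [hij]
    · simp
  intro x i
  rw [← ContinuousLinearMap.adjoint_inner_left, h2, inner_smul_left, Complex.conj_conj]

/-- It suffices that `b (k, m)` lies in the range of the `k`-th projection; the eigenspaces need not
be determined. -/
theorem isDiagonal_of_comp_landauProjection (hℓ : ℓ ≠ 0) (ε : ℝ)
    (hb : ∀ q, b q = (landauState ℓ q).toLp 2 volume) {T : L2Plane →L[ℂ] L2Plane} {t : ℕ → ℂ}
    (hT : ∀ k, T ∘L landauProjection ε ℓ k = t k • landauProjection ε ℓ k) :
    IsDiagonal b T (fun q => t q.1) := by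
  refine IsDiagonal.of_apply_self fun q => ?_
  have h := congrArg (fun S : L2Plane →L[ℂ] L2Plane => S (b q)) (hT q.1)
  simp only [ContinuousLinearMap.comp_apply, smul_apply] at h
  rwa [landauProjection_basis hℓ ε hb q.1 q.2] at h

theorem isOscillatorInverse_of_isDiagonal (hℓ : ℓ ≠ 0)
    (hb : ∀ q, b q = (landauState ℓ q).toLp 2 volume) {ξ : ℝ} (hξ : 0 ≤ ξ)
    {R : L2Plane →L[ℂ] L2Plane}
    (hR : IsDiagonal b R (fun q => 1 / (((q.1 : ℝ) + q.2 + (1 + 2 * ξ) : ℝ) : ℂ))) :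
    IsOscillatorInverse ℓ ξ R := by
  intro f g
  rw [mem_closureGraph_oscillatorExpr hℓ hb]
  have hne : ∀ q : ℕ × ℕ, (((q.1 : ℝ) + q.2 + (1 + 2 * ξ) : ℝ) : ℂ) ≠ 0 := fun q => by
    have : (0 : ℝ) < (q.1 : ℝ) + q.2 + (1 + 2 * ξ) := by positivity
    exact_mod_cast this.ne'
  have key : ∀ q, ⟪b q, R g⟫_ℂ = ⟪b q, f⟫_ℂ ↔ ⟪b q, g - (2 * (ξ : ℂ)) • f⟫_ℂ =
      (((q.1 : ℝ) + q.2 + 1 : ℝ) : ℂ) * ⟪b q, f⟫_ℂ := fun q => by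
    rw [hR]
    simp only [one_div]
    rw [inv_mul_eq_iff_eq_mul₀ (hne q), inner_sub_right, inner_smul_right,
      sub_eq_iff_eq_add]
    push_cast
    ring_nf
  constructor
  · rintro rfl q
    exact (key q).1 rfl
  · intro h
    exact b.ext_inner fun q => (key q).2 (h q)

end ClosureGraph

/-! ### Constant density of the Landau levels. -/

section Density

theorem HasSum.of_eq {ι E : Type*} [AddCommMonoid E] [TopologicalSpace E] {f g : ι → E} {a b : E}
    (h : HasSum f a) (hf : ∀ i, g i = f i) (ha : b = a) : HasSum g b := by
  rw [ha]
  exact h.congr_fun hf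

/-- The weights `1 / (2 ^ m m!)` make the sums of squares in a family satisfying the two
three-term relations of the Landau eigenfunctions grow as `2 ^ n n!`. -/
theorem hasSum_norm_sq_of_recurrence {a : ℕ → ℕ → ℂ} {z : ℂ} {S : ℝ}
    (h1 : ∀ n m, z * a n m = a (n + 1) m + 2 * m * a n (m - 1))
    (h2 : ∀ n m, (starRingEnd ℂ) z * a n m = a n (m + 1) + 2 * n * a (n - 1) m)
    (h0 : HasSum (fun m => ‖a 0 m‖ ^ 2 / (2 ^ m * m.factorial)) S) (n : ℕ) :
    HasSum (fun m => ‖a n m‖ ^ 2 / (2 ^ m * m.factorial)) (2 ^ n * n.factorial * S) := by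
  -- Crude geometric growth in `m`, needed only for the summability of `X` below. Doubling `R`
  -- absorbs the factor `m`.
  have hbd : ∀ n, ∃ C R : ℝ, 0 ≤ C ∧ 1 ≤ R ∧ ∀ m, ‖a n m‖ ≤ C * R ^ m := by
    intro n
    induction n with
    | zero =>
      refine ⟨‖a 0 0‖, 1 + ‖z‖, norm_nonneg _, by linarith [norm_nonneg z], fun m => ?_⟩
      induction m with
      | zero => simp
      | succ m ih =>
        have h := h2 0 m
        simp only [Nat.cast_zero, mul_zero, zero_mul, add_zero] at h
        rw [← h, norm_mul, RCLike.norm_conj, pow_succ]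
        calc ‖z‖ * ‖a 0 m‖ ≤ (1 + ‖z‖) * (‖a 0 0‖ * (1 + ‖z‖) ^ m) := by
              gcongr
              linarith
          _ = _ := by ring
    | succ n ih =>
      obtain ⟨C, R, hC, hR, h⟩ := ih
      refine ⟨C * (‖z‖ + 2), 2 * R, by positivity, by linarith, fun m => ?_⟩
      have e : a (n + 1) m = z * a n m - 2 * m * a n (m - 1) := by rw [h1]; ring
      have hm : (m : ℝ) ≤ 2 ^ m := by exact_mod_cast Nat.lt_two_pow_self.le
      have h2m : (1 : ℝ) ≤ 2 ^ m := one_le_pow₀ (by norm_num)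
      have h3 : ‖a n (m - 1)‖ ≤ C * R ^ m := (h (m - 1)).trans (by
        gcongr
        omega)
      calc ‖a (n + 1) m‖ ≤ ‖z * a n m‖ + ‖2 * (m : ℂ) * a n (m - 1)‖ := by
            rw [e]; exact norm_sub_le _ _
        _ = ‖z‖ * ‖a n m‖ + 2 * m * ‖a n (m - 1)‖ := by simp
        _ ≤ (‖z‖ * 2 ^ m) * (C * R ^ m) + 2 * 2 ^ m * (C * R ^ m) := by
            gcongr
            · exact le_mul_of_one_le_right (norm_nonneg _) h2m
            · exact h m
        _ = _ := by rw [mul_pow]; ring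
  induction n with
  | zero => simpa using h0
  | succ n ih =>
    obtain ⟨C, R, hC, hR, hCR⟩ := hbd n
    obtain ⟨C', R', hC', hR', hCR'⟩ := hbd (n + 1)
    let w : ℕ → ℂ := fun m => ((1 / (2 ^ m * m.factorial) : ℝ) : ℂ)
    have hw : ∀ m, ‖w m‖ ≤ 1 / m.factorial := fun m => by
      simp only [w]
      rw [Complex.norm_real, Real.norm_of_nonneg (by positivity)]
      gcongr
      exact le_mul_of_one_le_left (by positivity) (one_le_pow₀ (by norm_num))
    have hsucc : ∀ m, 2 * ((m + 1 : ℕ) : ℂ) * w (m + 1) = w m := fun m => by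
      simp only [w]
      rw [pow_succ, Nat.factorial_succ]
      push_cast
      field_simp
    let X : ℕ → ℂ := fun m => a n m * (starRingEnd ℂ) (a (n + 1) (m + 1)) * w m
    have hX : Summable X := by
      refine Summable.of_norm_bounded (g := fun m => C * (C' * R') * ((R * R') ^ m / m.factorial))
        ((Real.summable_pow_div_factorial (R * R')).mul_left _) fun m => ?_
      simp only [X]
      rw [norm_mul, norm_mul, RCLike.norm_conj]
      calc _ ≤ (C * R ^ m) * (C' * R' ^ (m + 1)) * (1 / m.factorial) := by
            gcongr
            · exact hCR m
            · exact hCR' (m + 1)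
            · exact hw m
        _ = _ := by rw [mul_pow, pow_succ]; ring
    -- `Y` is `X` shifted by one, because `2 (m + 1) w (m + 1) = w m`; the term at `m = 0` vanishes.
    -- Hence both have the same sum.
    let Y : ℕ → ℂ := fun m => 2 * m * a n (m - 1) * (starRingEnd ℂ) (a (n + 1) m) * w m
    have hY : HasSum Y (∑' m, X m) := by
      rw [← hasSum_nat_add_iff' 1]
      simp only [Finset.range_one, Finset.sum_singleton]
      have hY0 : Y 0 = 0 := by simp [Y]
      rw [hY0, sub_zero]
      refine hX.hasSum.of_eq (fun m => ?_) rfl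
      simp only [Y, X, Nat.add_sub_cancel, ← hsucc m]
      ring
    have hdiag : ∀ k m, ((‖a k m‖ ^ 2 / (2 ^ m * m.factorial) : ℝ) : ℂ) =
        a k m * (starRingEnd ℂ) (a k m) * w m := fun k m => by
      simp only [w]
      rw [Complex.mul_conj']
      push_cast
      ring
    rw [← Complex.hasSum_ofReal] at ih ⊢
    -- By `h1` the wanted series is this one minus `Y`. The conjugate of `h2` at `n + 1` rewrites
    -- this one as `X` plus `2 (n + 1)` times the series of level `n`, so the sums of `X` and `Y`
    -- cancel.
    have hZ : HasSum (fun m => z * a n m * (starRingEnd ℂ) (a (n + 1) m) * w m)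
        ((∑' m, X m) + 2 * (n + 1) * ((2 ^ n * n.factorial * S : ℝ) : ℂ)) := by
      refine (hX.hasSum.add (ih.mul_left (2 * ((n : ℂ) + 1)))).of_eq (fun m => ?_) rfl
      have h := congrArg (starRingEnd ℂ) (h2 (n + 1) m)
      rw [map_mul, Complex.conj_conj] at h
      rw [mul_right_comm z, h, hdiag]
      simp only [X, Nat.add_sub_cancel, map_add, map_mul, map_ofNat, Complex.conj_natCast]
      push_cast
      ring
    refine (hZ.sub hY).of_eq (fun m => ?_) ?_
    · rw [hdiag]
      simp only [Y]
      rw [h1]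
      ring
    · rw [Nat.factorial_succ]
      push_cast
      ring

variable {ℓ : ℝ}

/-- The local density of every Landau level is the constant `1 / (2πℓ²)`. -/
theorem hasSum_norm_sq_landauState (hℓ : ℓ ≠ 0) (n : ℕ) (x : Plane) :
    HasSum (fun m => ‖landauState ℓ (n, m) x‖ ^ 2) (1 / (2 * Real.pi * ℓ ^ 2)) := by
  have hpi := Real.pi_pos
  set z : ℂ := (1 / (ℓ : ℂ)) * ((x 0 : ℂ) + I * x 1) with hz
  have hzc : (starRingEnd ℂ) z = (1 / (ℓ : ℂ)) * ((x 0 : ℂ) - I * x 1) := by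
    simp only [hz, map_mul, map_div₀, map_one, map_add, Complex.conj_ofReal, Complex.conj_I]
    ring
  have h1 : ∀ n m, z * landauFun ℓ n m x =
      landauFun ℓ (n + 1) m x + 2 * m * landauFun ℓ n (m - 1) x := fun n m => by
    have h := raising_add_lowering hℓ I (landauFun ℓ n m)
    rw [raising_landauFun, lowering_neg_landauFun hℓ] at h
    have h' := congrArg (fun f : 𝓢(Plane, ℂ) => f x) h
    simp only [add_apply, smul_apply, smul_eq_mul, coordMul_apply] at h'
    rw [h', hz]
    ring
  have h2 : ∀ n m, (starRingEnd ℂ) z * landauFun ℓ n m x =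
      landauFun ℓ n (m + 1) x + 2 * n * landauFun ℓ (n - 1) m x := fun n m => by
    have h := raising_add_lowering hℓ (-I) (landauFun ℓ n m)
    rw [raising_neg_landauFun, neg_neg, lowering_landauFun hℓ] at h
    have h' := congrArg (fun f : 𝓢(Plane, ℂ) => f x) h
    simp only [add_apply, smul_apply, smul_eq_mul, coordMul_apply] at h'
    rw [h', hzc]
    ring
  have hz2 : ‖z‖ ^ 2 = ‖x‖ ^ 2 / ℓ ^ 2 := by
    have e : (((‖z‖ ^ 2 : ℝ)) : ℂ) = ((‖x‖ ^ 2 / ℓ ^ 2 : ℝ) : ℂ) := by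
      rw [Complex.ofReal_pow, ← Complex.mul_conj', hzc, hz, EuclideanSpace.norm_sq_eq]
      simp only [Fin.sum_univ_two, Real.norm_eq_abs, sq_abs]
      push_cast
      have hI : I ^ 2 = -1 := Complex.I_sq
      ring_nf
      rw [hI]
      ring
    exact_mod_cast e
  have hpow : ∀ m, landauFun ℓ 0 m x = (starRingEnd ℂ) z ^ m * groundState ℓ x := fun m => by
    induction m with
    | zero => simp [landauFun]
    | succ m ih =>
      have h := h2 0 m
      simp only [Nat.cast_zero, mul_zero, zero_mul, add_zero] at h
      rw [← h, ih, pow_succ]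
      ring
  -- In the lowest level the series is that of `exp (‖z‖² / 2)`, which the squared Gaussian cancels
  -- exactly.
  have h0 : HasSum (fun m => ‖landauFun ℓ 0 m x‖ ^ 2 / (2 ^ m * m.factorial)) 1 := by
    have hexp := NormedSpace.expSeries_div_hasSum_exp (‖z‖ ^ 2 / 2)
    rw [← Real.exp_eq_exp_ℝ] at hexp
    refine (hexp.mul_right (‖groundState ℓ x‖ ^ 2)).of_eq (fun m => ?_) ?_
    · rw [hpow, norm_mul, norm_pow, RCLike.norm_conj, div_pow]
      field_simp
      ring
    · rw [groundState_apply hℓ, Complex.norm_real, Real.norm_of_nonneg (Real.exp_pos _).le,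
        ← Real.exp_nat_mul, ← Real.exp_add, hz2, eq_comm, Real.exp_eq_one_iff]
      push_cast
      field_simp
      ring
  have h := (hasSum_norm_sq_of_recurrence h1 h2 h0 n).mul_left
    (1 / (2 ^ n * n.factorial * (2 * Real.pi * ℓ ^ 2)))
  refine h.of_eq (fun m => ?_) ?_
  · have hN := landauNormSq_pos hℓ n m
    rw [landauState, smul_apply, norm_smul, Complex.norm_real, norm_inv,
      Real.norm_of_nonneg (Real.sqrt_nonneg _), mul_pow, inv_pow, Real.sq_sqrt hN.le, landauNormSq]
    field_simp
  · field_simp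

end Density

/-! ### Traces of compressions and the trace per unit volume. -/

section UnitVolume

theorem chiMul_ae_eq (Λ : Set Plane) (hΛ : MeasurableSet Λ) (f : L2Plane) :
    (chiMul Λ hΛ f : Plane → ℂ) =ᵐ[volume] Λ.indicator (f : Plane → ℂ) :=
  chiMulLinear_ae_eq Λ hΛ f

theorem adjoint_chiMul (Λ : Set Plane) (hΛ : MeasurableSet Λ) :
    ContinuousLinearMap.adjoint (chiMul Λ hΛ) = chiMul Λ hΛ := by
  refine ((ContinuousLinearMap.eq_adjoint_iff _ _).2 fun f g => ?_).symm
  rw [L2.inner_def, L2.inner_def]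
  refine integral_congr_ae ?_
  filter_upwards [chiMul_ae_eq Λ hΛ f, chiMul_ae_eq Λ hΛ g] with x hf hg
  rw [hf, hg]
  by_cases h : x ∈ Λ <;> simp [h]

theorem norm_sq_chiMul_toLp (Λ : Set Plane) (hΛ : MeasurableSet Λ) (f : 𝓢(Plane, ℂ)) :
    ‖chiMul Λ hΛ (f.toLp 2 volume)‖ ^ 2 = ∫ x in Λ, ‖f x‖ ^ 2 := by
  have hsq : ((‖chiMul Λ hΛ (f.toLp 2 volume)‖ : ℂ)) ^ 2 =
      ⟪chiMul Λ hΛ (f.toLp 2 volume), chiMul Λ hΛ (f.toLp 2 volume)⟫_ℂ :=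
    (inner_self_eq_norm_sq_to_K (𝕜 := ℂ) (chiMul Λ hΛ (f.toLp 2 volume))).symm
  rw [← integral_indicator hΛ, ← Complex.ofReal_inj, Complex.ofReal_pow, hsq, L2.inner_def,
    ← integral_complex_ofReal]
  refine integral_congr_ae ?_
  filter_upwards [chiMul_ae_eq Λ hΛ (f.toLp 2 volume), f.coeFn_toLp 2 volume] with x hx hf
  rw [hx]
  by_cases h : x ∈ Λ
  · simp [h, hf]
  · simp [h]

variable {ℓ : ℝ} {b : HilbertBasis (ℕ × ℕ) ℂ L2Plane}

theorem hasSum_norm_sq_chiMul (hℓ : ℓ ≠ 0) (hb : ∀ q, b q = (landauState ℓ q).toLp 2 volume)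
    {Λ : Set Plane} (hΛ : MeasurableSet Λ) (hfin : volume Λ ≠ ∞) (n : ℕ) :
    HasSum (fun m => ‖chiMul Λ hΛ (b (n, m))‖ ^ 2)
      ((volume Λ).toReal * (1 / (2 * Real.pi * ℓ ^ 2))) := by
  have : IsFiniteMeasure (volume.restrict Λ) := ⟨by simpa using hfin.lt_top⟩
  have hc : ∀ m, Continuous fun x => ‖landauState ℓ (n, m) x‖ ^ 2 := fun m =>
    ((landauState ℓ (n, m)).continuous.norm).pow 2
  have h := hasSum_integral_of_dominated_convergence (μ := volume.restrict Λ)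
    (F := fun m x => ‖landauState ℓ (n, m) x‖ ^ 2) (f := fun _ => 1 / (2 * Real.pi * ℓ ^ 2))
    (fun m x => ‖landauState ℓ (n, m) x‖ ^ 2) (fun m => (hc m).aestronglyMeasurable)
    (fun m => ae_of_all _ fun x => (Real.norm_of_nonneg (sq_nonneg _)).le)
    (ae_of_all _ fun x => (hasSum_norm_sq_landauState hℓ n x).summable)
    (by simp only [fun x => (hasSum_norm_sq_landauState hℓ n x).tsum_eq]
        exact integrable_const _)
    (ae_of_all _ fun x => hasSum_norm_sq_landauState hℓ n x)
  refine h.of_eq (fun m => ?_) ?_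
  · rw [hb, norm_sq_chiMul_toLp]
  · rw [setIntegral_const, smul_eq_mul, Measure.real]

/-- Summing `t n * ‖χ b (n, m)‖²` over `m` first gives `t n` times the integrated density, which is
the same for all `n`. -/
theorem hasTrace_chiMul_conj (hℓ : ℓ ≠ 0) (hb : ∀ q, b q = (landauState ℓ q).toLp 2 volume)
    {T : L2Plane →L[ℂ] L2Plane} {t : ℕ → ℂ} (ht : Summable fun k => ‖t k‖)
    (hT : IsDiagonal b T (fun q => t q.1)) {Λ : Set Plane} (hΛ : MeasurableSet Λ)
    (hfin : volume Λ ≠ ∞) :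
    HasTrace (chiMul Λ hΛ ∘L T ∘L chiMul Λ hΛ)
      ((((volume Λ).toReal * (1 / (2 * Real.pi * ℓ ^ 2)) : ℝ) : ℂ) * ∑' k, t k) := by
  have hsum := hasSum_norm_sq_chiMul hℓ hb hΛ hfin
  have hs : Summable fun q : ℕ × ℕ => ‖t q.1‖ * ‖chiMul Λ hΛ (b q)‖ ^ 2 := by
    refine (summable_prod_of_nonneg fun q => by positivity).2 ⟨fun n => ?_, ?_⟩
    · exact ((hsum n).mul_left ‖t n‖).summable
    · simp only [fun n => ((hsum n).mul_left ‖t n‖).tsum_eq]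
      exact ht.mul_right _
  have htr := hT.hasTrace_conj (adjoint_chiMul Λ hΛ) (C := ∑' k, ‖t k‖)
    (fun q => ht.le_tsum q.1 fun _ _ => norm_nonneg _) hs
  have hsC : Summable fun q : ℕ × ℕ => t q.1 * ((‖chiMul Λ hΛ (b q)‖ ^ 2 : ℝ) : ℂ) := by
    refine Summable.of_norm (hs.congr fun q => ?_)
    rw [norm_mul, Complex.norm_real, Real.norm_of_nonneg (sq_nonneg _)]
  have hfib := hsC.hasSum.prod_fiberwise fun n =>
    ((Complex.hasSum_ofReal.2 (hsum n)).mul_left (t n))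
  have huniq := hfib.unique (ht.of_norm.hasSum.mul_right _)
  rwa [huniq, mul_comm] at htr

theorem hasTracePerUnitVolume_of_isDiagonal (hℓ : ℓ ≠ 0)
    (hb : ∀ q, b q = (landauState ℓ q).toLp 2 volume)
    {T : L2Plane →L[ℂ] L2Plane} {t : ℕ → ℂ} (ht : Summable fun k => ‖t k‖)
    (hT : IsDiagonal b T (fun q => t q.1)) {Λ : ℕ → Set Plane} (hΛ : IsFoelnerExhaustion Λ) :
    HasTracePerUnitVolume hΛ T (1 / (2 * (magneticArea ℓ : ℂ)) * ∑' k, t k) := by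
  refine ⟨fun n => _, fun n => hasTrace_chiMul_conj hℓ hb ht hT (hΛ.isCompact n).measurableSet
    (hΛ.isCompact n).measure_lt_top.ne, ?_⟩
  have hlim : Tendsto (volume ∘ Λ) atTop (𝓝 (volume (⋃ n, Λ n))) :=
    tendsto_measure_iUnion_atTop hΛ.monotone
  have hpos : (0 : ℝ≥0∞) < volume (⋃ n, Λ n) := by
    rw [hΛ.iUnion_eq]
    exact Measure.measure_univ_pos.2 (NeZero.ne _)
  -- The first sets may be null. Once the volume is positive, the quotient equals the limit exactly.
  refine tendsto_const_nhds.congr' ?_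
  filter_upwards [hlim.eventually_const_lt hpos] with n hn
  have hv : ((volume (Λ n)).toReal : ℂ) ≠ 0 := Complex.ofReal_ne_zero.2
    (ENNReal.toReal_pos hn.ne' (hΛ.isCompact n).measure_lt_top.ne).ne'
  have hℓ' : (ℓ : ℂ) ≠ 0 := Complex.ofReal_ne_zero.2 hℓ
  have hpi : (Real.pi : ℂ) ≠ 0 := Complex.ofReal_ne_zero.2 Real.pi_ne_zero
  rw [magneticArea]
  push_cast
  field_simp

theorem exists_isOscillatorInverse_hasDixmierTrace (hℓ : ℓ ≠ 0)
    (hb : ∀ q, b q = (landauState ℓ q).toLp 2 volume)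
    {T : L2Plane →L[ℂ] L2Plane} {t : ℕ → ℂ} (ht : Summable fun k => ‖t k‖)
    (hT : IsDiagonal b T (fun q => t q.1)) {ξ : ℝ} (hξ : 0 ≤ ξ) :
    ∃ R : L2Plane →L[ℂ] L2Plane, IsOscillatorInverse ℓ ξ R ∧
      HasDixmierTrace (R ∘L T) (∑' k, t k) := by
  obtain ⟨R, hR⟩ := exists_isDiagonal b (C := 1)
    (fun q => 1 / (((q.1 : ℝ) + q.2 + (1 + 2 * ξ) : ℝ) : ℂ)) fun q => by
      have h : (1 : ℝ) ≤ (q.1 : ℝ) + q.2 + (1 + 2 * ξ) := by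
        have h1 : (0 : ℝ) ≤ q.1 := q.1.cast_nonneg
        have h2 : (0 : ℝ) ≤ q.2 := q.2.cast_nonneg
        linarith
      rw [norm_div, norm_one, Complex.norm_real, Real.norm_of_nonneg (by linarith)]
      exact div_le_one_of_le₀ h (by linarith)
  refine ⟨R, isOscillatorInverse_of_isDiagonal hℓ hb hξ hR, ?_⟩
  refine IsDiagonal.hasDixmierTrace (b := b) (a := 1 + 2 * ξ) ht (by linarith) ?_
  exact (hR.comp hT).congr fun q => by ring

end UnitVolume

theorem mainTheorem2 (ε ℓ : ℝ) (hε : 0 < ε) (hℓ : 0 < ℓ)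
    (T : L2Plane →L[ℂ] L2Plane) (hT : T ∈ landauIdeal ε ℓ) :
    ∃ d : ℂ,
      (∀ ξ : ℝ, 0 ≤ ξ →
        ∃ R : L2Plane →L[ℂ] L2Plane, IsOscillatorInverse ℓ ξ R ∧ HasDixmierTrace (R ∘L T) d) ∧
      ∀ (Λ : ℕ → Set Plane) (hΛ : IsFoelnerExhaustion Λ),
        HasTracePerUnitVolume hΛ T (1 / (2 * (magneticArea ℓ : ℂ)) * d) := by
  obtain ⟨-, t, ht, hTt⟩ := hT
  obtain ⟨b, hb⟩ := exists_landauBasis hℓ.ne'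
  have hdiag := isDiagonal_of_comp_landauProjection hℓ.ne' ε hb hTt
  exact ⟨∑' k, t k,
    fun ξ hξ => exists_isOscillatorInverse_hasDixmierTrace hℓ.ne' hb ht hdiag hξ,
    fun Λ hΛ => hasTracePerUnitVolume_of_isDiagonal hℓ.ne' hb ht hdiag hΛ⟩
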